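/- Let $\mu,\nu\in\mathcal P_2(\mathbb R^d)$, the set of Borel probability measures on $\mathbb R^d$ with finite second order moment. Let $W_2^2(\mu,\nu)=\inf_{\pi\in\Pi(\mu,\nu)}\int|y-x|^2\,\pi(dx,dy)$, where $\Pi(\mu,\nu)$ is the set of measures on $\mathbb R^d\times\mathbb R^d$ with marginals $\mu$ and $\nu$, and let $\Pi^{opt}(\mu,\nu)$ be the set of $\pi\in\Pi(\mu,\nu)$ attaining this infimum. Write $\eta\le_{cx}\nu$ if $\int\phi\,d\eta\le\int\phi\,d\nu$ for each convex $\phi:\mathbb R^d\to\mathbb R$ such that both integrals make sense (possibly infinite). Define $$\mathcal I_\mu^\nu=\Big\{\eta\in\mathcal P_2(\mathbb R^d):\ \eta\le_{cx}\nu,\ W_2^2(\mu,\nu)=W_2^2(\mu,\eta)+\int|y|^2\nu(dy)-\int|z|^2\eta(dz)\Big\},$$ $$\tilde{\mathcal I}_\mu^\nu=\Big\{\mathcal T\#\mu:\ \mathcal T(x)=\int y\,k(x,dy)\ \text{for some Markov kernel } k \text{ with } \mu(dx)k(x,dy)\in\Pi^{opt}(\mu,\nu)\Big\}.$$ Let $\phi:\mathbb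 R^d\to\mathbb R$ be strictly convex with $\int\phi\,d\nu<\infty$, and let $$\mathcal I_{\mu,\phi}^\nu=\Big\{\eta\in\mathcal I_\mu^\nu:\ \int\phi\,d\eta=\inf_{\eta'\in\mathcal I_\mu^\nu}\int\phi\,d\eta'\Big\}.$$ Then: (i) $\emptyset\ne\mathcal I_{\mu,\phi}^\nu\subset\tilde{\mathcal I}_\mu^\nu$; (ii) for each $\eta\in\mathcal I_{\mu,\phi}^\nu$ there is a measurable map $T:\mathbb R^d\to\mathbb R^d$ such that $\Pi^{opt}(\mu,\eta)=\{(I_d,T)\#\mu\}$, where $I_d$ is the identity map of $\mathbb R^d$; (iii) there is exactly one $\eta_\phi\in\mathcal I_{\mu,\phi}^\nu$ such that $\int|z|^2\eta_\phi(dz)=\inf_{\eta\in\mathcal I_{\mu,\phi}^\nu}\int|z|^2\eta(dz)$. Moreover, for the function $x\mapsto|x|^2$, the set $\mathcal I_{\mu,|x|^2}^\nu$ contains exactly one element $\underline\eta$. -/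

import Mathlib

open MeasureTheory ProbabilityTheory
open scoped ENNReal

noncomputable section

namespace QuadraticOT

/-- `ℝ^d` with the Euclidean norm. -/
abbrev Space (d : ℕ) : Type := EuclideanSpace ℝ (Fin d)

variable {d : ℕ}

/-- `𝒫₂(ℝ^d)`: Borel probability measures with finite second order moment. -/
def P2 (d : ℕ) : Set (Measure (Space d)) :=
  {μ | IsProbabilityMeasure μ ∧ ∫⁻ x, ‖x‖ₑ ^ 2 ∂μ < ⊤}

/-- `Π(μ, ν)`: measures on the product with marginals `μ` and `ν`. -/
def couplings (μ ν : Measure (Space d)) : Set (Measure (Space d × Space d)) :=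
  {π | π.map Prod.fst = μ ∧ π.map Prod.snd = ν}

/-- The quadratic transport cost `∫ |y - x|² π(dx, dy)`, with values in `[0, ∞]`. -/
def quadCost (π : Measure (Space d × Space d)) : ℝ≥0∞ :=
  ∫⁻ p, ‖p.2 - p.1‖ₑ ^ 2 ∂π

/-- The squared quadratic Wasserstein distance `W₂²(μ, ν)`, with values in `[0, ∞]`.
It is finite when `μ` and `ν` belong to `𝒫₂(ℝ^d)`. -/
def W2sq (μ ν : Measure (Space d)) : ℝ≥0∞ :=
  ⨅ π ∈ couplings μ ν, quadCost π

/-- `Π^opt(μ, ν)`: the optimal couplings for the quadratic cost. When `μ` and `ν` have finite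
second moments, so does every coupling of them. -/
def optCouplings (μ ν : Measure (Space d)) : Set (Measure (Space d × Space d)) :=
  {π | π ∈ couplings μ ν ∧ quadCost π = W2sq μ ν}

/-- The integral of `φ` makes sense in `[-∞, ∞]`: the positive and the negative part do not both
have infinite integral. (It is used for convex, hence continuous, functions `φ` only.) -/
def IntegralMakesSense (φ : Space d → ℝ) (η : Measure (Space d)) : Prop :=
  ∫⁻ x, ENNReal.ofReal (φ x) ∂η ≠ ⊤ ∨ ∫⁻ x, ENNReal.ofReal (-φ x) ∂η ≠ ⊤

/-- The integral `∫ φ dη` with values in `[-∞, ∞]`, as the integral of the positive part minus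
the integral of the negative part. It is the intended one under `IntegralMakesSense φ η`, which
is automatic for convex `φ` and `η ∈ 𝒫₂(ℝ^d)`. -/
def extIntegral (φ : Space d → ℝ) (η : Measure (Space d)) : EReal :=
  ((∫⁻ x, ENNReal.ofReal (φ x) ∂η : ℝ≥0∞) : EReal)
    - ((∫⁻ x, ENNReal.ofReal (-φ x) ∂η : ℝ≥0∞) : EReal)

/-- The convex order `η ≤_cx ν`: `∫ φ dη ≤ ∫ φ dν` for each convex `φ : ℝ^d → ℝ` such that the
integrals make sense (possibly being infinite). -/
def ConvexOrder (η ν : Measure (Space d)) : Prop :=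
  ∀ φ : Space d → ℝ, ConvexOn ℝ Set.univ φ →
    IntegralMakesSense φ η → IntegralMakesSense φ ν → extIntegral φ η ≤ extIntegral φ ν

/-- `ℐ_μ^ν`: the `η ∈ 𝒫₂(ℝ^d)` such that `η ≤_cx ν` and
`W₂²(μ, ν) = W₂²(μ, η) + ∫ |y|² ν(dy) - ∫ |z|² η(dz)`. For `μ, ν ∈ 𝒫₂(ℝ^d)` the four terms
are finite. -/
def interSet (μ ν : Measure (Space d)) : Set (Measure (Space d)) :=
  {η | η ∈ P2 d ∧ ConvexOrder η ν ∧
    (W2sq μ ν).toReal = (W2sq μ η).toReal + ∫ y, ‖y‖ ^ 2 ∂ν - ∫ z, ‖z‖ ^ 2 ∂η}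

/-- The set of barycentric images `𝒯#μ`, `𝒯(x) = ∫ y k(x, dy)`, of the optimal couplings
`μ(dx) k(x, dy)` between `μ` and `ν`. -/
def baryImages (μ ν : Measure (Space d)) : Set (Measure (Space d)) :=
  {η | ∃ k : Kernel (Space d) (Space d), IsMarkovKernel k ∧ μ ⊗ₘ k ∈ optCouplings μ ν ∧
    η = μ.map (fun x => ∫ y, y ∂(k x))}

/-- The set of minimizers of `η ↦ ∫ φ dη` over the set `S` of measures. -/
def minimizers (S : Set (Measure (Space d))) (φ : Space d → ℝ) : Set (Measure (Space d)) :=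
  {η | η ∈ S ∧ extIntegral φ η = ⨅ η' ∈ S, extIntegral φ η'}

end QuadraticOT

end

noncomputable section

namespace QuadraticOT

open Filter
open scoped RealInnerProductSpace Topology

/-! ### Quadratic cost, correlation, and compactness of the set of couplings -/

section

variable {d : ℕ} {μ ν η : Measure (Space d)} {π : Measure (Space d × Space d)}

/-! The problem is moved to the Hilbert space `L²(μ)`. Expanding the square, minimal cost means
maximal correlation `∫ ⟪x, y⟫ dπ`, and `η ∈ interSet μ ν` says that `η ≤_cx ν` and that the maximal
correlations of `μ` with `η` and with `ν` agree. The correlation of a coupling depends only on its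
barycentric projection `T`, being `∫ ⟪x, T x⟫ dμ`.

By Strassen's theorem (`mem_baryLp_of_convexOrder`, with Jensen for the converse), the projections
of couplings of `μ` and `ν` are exactly the `T ∈ L²(μ)` with `T#μ ≤_cx ν`. They form a closed,
convex, bounded set, and the optimal ones `baryOpt μ ν` form its slice by a hyperplane. Hence `T ↦ ∫
φ(T) dμ` has a minimizer `T₀` on `baryOpt μ ν`, unique by strict convexity.

Elements of `baryOpt μ ν` push `μ` into `interSet μ ν`. Conversely, for `η ∈ interSet μ ν`, an
optimal coupling of `μ` and `η` has its projection `T` in `baryOpt μ ν`, so `∫ φ(T₀) dμ ≤ ∫ φ(T) dμ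
≤ ∫ φ dη` by Jensen. If `η` is a minimizer both inequalities are equalities: the first gives `T =
T₀`, the second that the coupling is carried by the graph of `T₀`. Thus `T₀#μ` is the only
minimizer, and the selection by second moment takes place in a one-point set. -/

lemma eLpNorm_two_lt_top_iff {α : Type*} [MeasurableSpace α] {ρ : Measure α} {f : α → Space d} :
    eLpNorm f 2 ρ < ⊤ ↔ ∫⁻ x, ‖f x‖ₑ ^ 2 ∂ρ < ⊤ := by
  rw [eLpNorm_lt_top_iff_lintegral_rpow_enorm_lt_top (by simp) (by simp)]
  simp

lemma mem_P2_iff : μ ∈ P2 d ↔ IsProbabilityMeasure μ ∧ MemLp id 2 μ := by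
  simp only [P2, Set.mem_ofPred_eq, MemLp, eLpNorm_two_lt_top_iff, id_eq]
  exact ⟨fun h => ⟨h.1, aestronglyMeasurable_id, h.2⟩, fun h => ⟨h.1, h.2.2⟩⟩

lemma isProbabilityMeasure_of_mem_P2 (h : μ ∈ P2 d) : IsProbabilityMeasure μ := h.1

lemma memLp_id_of_mem_P2 (h : μ ∈ P2 d) : MemLp id 2 μ := (mem_P2_iff.1 h).2

lemma map_mem_P2 {α : Type*} [MeasurableSpace α] {ρ : Measure α} [IsProbabilityMeasure ρ]
    {T : α → Space d} (hT : MemLp T 2 ρ) : ρ.map T ∈ P2 d := by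
  rw [mem_P2_iff]
  refine ⟨Measure.isProbabilityMeasure_map hT.1.aemeasurable, ?_⟩
  rw [memLp_map_measure_iff aestronglyMeasurable_id hT.1.aemeasurable]
  exact hT

lemma integrable_inner_of_memLp {α : Type*} [MeasurableSpace α] {ρ : Measure α}
    {f g : α → Space d} (hf : MemLp f 2 ρ) (hg : MemLp g 2 ρ) :
    Integrable (fun x => ⟪f x, g x⟫) ρ := by
  refine (L2.integrable_inner (𝕜 := ℝ) (hf.toLp f) (hg.toLp g)).congr ?_
  filter_upwards [hf.coeFn_toLp, hg.coeFn_toLp] with x h1 h2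
  rw [h1, h2]

lemma inner_toLp {α : Type*} [MeasurableSpace α] {ρ : Measure α}
    {f g : α → Space d} (hf : MemLp f 2 ρ) (hg : MemLp g 2 ρ) :
    ⟪hf.toLp f, hg.toLp g⟫ = ∫ x, ⟪f x, g x⟫ ∂ρ := by
  rw [L2.inner_def]
  refine integral_congr_ae ?_
  filter_upwards [hf.coeFn_toLp, hg.coeFn_toLp] with x h1 h2
  rw [h1, h2]

lemma couplings.measurePreserving_fst (h : π ∈ couplings μ ν) :
    MeasurePreserving Prod.fst π μ := ⟨measurable_fst, h.1⟩

lemma couplings.measurePreserving_snd (h : π ∈ couplings μ ν) :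
    MeasurePreserving Prod.snd π ν := ⟨measurable_snd, h.2⟩

lemma couplings.isProbabilityMeasure [hμ : IsProbabilityMeasure μ] (h : π ∈ couplings μ ν) :
    IsProbabilityMeasure π := by
  rw [← h.1] at hμ
  exact Measure.isProbabilityMeasure_of_map Prod.fst

lemma couplings.memLp_fst {f : Space d → Space d} (h : π ∈ couplings μ ν) (hf : MemLp f 2 μ) :
    MemLp (fun p => f p.1) 2 π :=
  hf.comp_measurePreserving (couplings.measurePreserving_fst h)

lemma couplings.memLp_snd {f : Space d → Space d} (h : π ∈ couplings μ ν) (hf : MemLp f 2 ν) :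
    MemLp (fun p => f p.2) 2 π :=
  hf.comp_measurePreserving (couplings.measurePreserving_snd h)

lemma couplings.integrable_inner {f g : Space d → Space d} (h : π ∈ couplings μ ν)
    (hf : MemLp f 2 μ) (hg : MemLp g 2 ν) :
    Integrable (fun p => ⟪f p.1, g p.2⟫) π :=
  integrable_inner_of_memLp (couplings.memLp_fst h hf) (couplings.memLp_snd h hg)

/-- The correlation `∫ ⟪x, y⟫ π(dx, dy)`. -/
def corr (π : Measure (Space d × Space d)) : ℝ := ∫ p, ⟪p.1, p.2⟫ ∂π

/-- The second moment `∫ |x|² μ(dx)`. -/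
def secondMoment (μ : Measure (Space d)) : ℝ := ∫ x, ‖x‖ ^ 2 ∂μ

/-- Expanding the square isolates the only term that depends on the coupling beyond its marginals.
The sign is recorded because `ENNReal.ofReal` reflects the order only towards a nonnegative bound.
-/
lemma quadCost_eq (hμ : μ ∈ P2 d) (hν : ν ∈ P2 d) (h : π ∈ couplings μ ν) :
    quadCost π = ENNReal.ofReal (secondMoment μ + secondMoment ν - 2 * corr π) ∧
      0 ≤ secondMoment μ + secondMoment ν - 2 * corr π := by
  have h1 := couplings.memLp_fst h (memLp_id_of_mem_P2 hμ)
  have h2 := couplings.memLp_snd h (memLp_id_of_mem_P2 hν)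
  have := isProbabilityMeasure_of_mem_P2 hμ
  have := couplings.isProbabilityMeasure h
  have h12 := couplings.integrable_inner h (memLp_id_of_mem_P2 hμ) (memLp_id_of_mem_P2 hν)
  simp only [id_eq] at h1 h2 h12
  have e1 : secondMoment μ = ∫ p, ‖p.1‖ ^ 2 ∂π := by
    rw [secondMoment, ← h.1, integral_map measurable_fst.aemeasurable]
    exact (by fun_prop : Continuous fun x : Space d => ‖x‖ ^ 2).aestronglyMeasurable
  have e2 : secondMoment ν = ∫ p, ‖p.2‖ ^ 2 ∂π := by
    rw [secondMoment, ← h.2, integral_map measurable_snd.aemeasurable]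
    exact (by fun_prop : Continuous fun x : Space d => ‖x‖ ^ 2).aestronglyMeasurable
  have key : secondMoment μ + secondMoment ν - 2 * corr π = ∫ p, ‖p.2 - p.1‖ ^ 2 ∂π := by
    have h3 : Integrable (fun p => ‖p.1‖ ^ 2 + ‖p.2‖ ^ 2) π :=
      h1.integrable_norm_pow'.add h2.integrable_norm_pow'
    rw [e1, e2, corr, ← integral_const_mul, ← integral_add h1.integrable_norm_pow'
      h2.integrable_norm_pow', ← integral_sub h3 (h12.const_mul 2)]
    congr 1 with p
    rw [norm_sub_sq_real, real_inner_comm]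
    ring
  refine ⟨?_, ?_⟩
  · rw [key, quadCost, ofReal_integral_eq_lintegral_ofReal]
    · congr 1 with p
      rw [ENNReal.ofReal_pow (norm_nonneg _), ofReal_norm]
    · exact (h2.sub h1).integrable_norm_pow'
    · exact ae_of_all _ fun p => by positivity
  · rw [key]
    positivity

lemma mem_optCouplings_iff (hμ : μ ∈ P2 d) (hν : ν ∈ P2 d) :
    π ∈ optCouplings μ ν ↔ π ∈ couplings μ ν ∧ ∀ π' ∈ couplings μ ν, corr π' ≤ corr π := by
  refine and_congr_right fun h => ?_
  constructor
  · intro hopt π' h'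
    have : quadCost π ≤ quadCost π' := hopt ▸ iInf₂_le π' h'
    rw [(quadCost_eq hμ hν h).1, (quadCost_eq hμ hν h').1,
      ENNReal.ofReal_le_ofReal_iff (quadCost_eq hμ hν h').2] at this
    linarith
  · intro hle
    refine le_antisymm (le_iInf₂ fun π' h' => ?_) (iInf₂_le π h)
    rw [(quadCost_eq hμ hν h).1, (quadCost_eq hμ hν h').1]
    exact ENNReal.ofReal_le_ofReal (by linarith [hle π' h'])

lemma W2sq_toReal (hμ : μ ∈ P2 d) (hν : ν ∈ P2 d) (h : π ∈ optCouplings μ ν) :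
    (W2sq μ ν).toReal = secondMoment μ + secondMoment ν - 2 * corr π := by
  rw [← h.2, (quadCost_eq hμ hν h.1).1, ENNReal.toReal_ofReal (quadCost_eq hμ hν h.1).2]

lemma prod_mem_couplings [IsProbabilityMeasure μ] [IsProbabilityMeasure ν] :
    μ.prod ν ∈ couplings μ ν := by
  constructor <;> simp

lemma map_graph_mem_couplings {T : Space d → Space d} (hT : AEMeasurable T μ) :
    μ.map (fun x => (x, T x)) ∈ couplings μ (μ.map T) := by
  have hg : AEMeasurable (fun x => (x, T x)) μ := aemeasurable_id.prodMk hT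
  constructor
  · rw [AEMeasurable.map_map_of_aemeasurable measurable_fst.aemeasurable hg]
    exact Measure.map_id
  · rw [AEMeasurable.map_map_of_aemeasurable measurable_snd.aemeasurable hg]
    rfl

lemma smul_add_smul_mem_couplings {π' : Measure (Space d × Space d)} (h : π ∈ couplings μ ν)
    (h' : π' ∈ couplings μ ν) {a b : ℝ≥0∞} (hab : a + b = 1) :
    a • π + b • π' ∈ couplings μ ν := by
  constructor
  · rw [Measure.map_add _ _ measurable_fst, Measure.map_smul, Measure.map_smul, h.1, h'.1,
      ← add_smul, hab, one_smul]
  · rw [Measure.map_add _ _ measurable_snd, Measure.map_smul, Measure.map_smul, h.2, h'.2,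
      ← add_smul, hab, one_smul]

/-- The set `couplings μ ν` is relatively compact for the weak topology and closed. -/
lemma exists_tendsto_coupling [IsProbabilityMeasure μ] [IsProbabilityMeasure ν]
    (U : Ultrafilter ℕ) (π : ℕ → ProbabilityMeasure (Space d × Space d))
    (h : ∀ n, (π n : Measure (Space d × Space d)) ∈ couplings μ ν) :
    ∃ ρ : ProbabilityMeasure (Space d × Space d),
      (ρ : Measure (Space d × Space d)) ∈ couplings μ ν ∧ Tendsto π U (𝓝 ρ) := by
  have htight : IsTightMeasureSet
      {((ρ : ProbabilityMeasure (Space d × Space d)) : Measure (Space d × Space d)) |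
        ρ ∈ Set.range π} := by
    rw [isTightMeasureSet_iff_exists_isCompact_measure_compl_le]
    intro ε hε
    obtain ⟨K, hK, hKμ⟩ := isTightMeasureSet_iff_exists_isCompact_measure_compl_le.1
      (isTightMeasureSet_singleton (μ := μ)) (ε / 2) (ENNReal.half_pos hε.ne')
    obtain ⟨L, hL, hLν⟩ := isTightMeasureSet_iff_exists_isCompact_measure_compl_le.1
      (isTightMeasureSet_singleton (μ := ν)) (ε / 2) (ENNReal.half_pos hε.ne')
    -- The complement of the product lies in two strips, whose masses are read off the marginals,
    -- uniformly in the coupling.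
    refine ⟨K ×ˢ L, hK.prod hL, ?_⟩
    rintro _ ⟨_, ⟨n, rfl⟩, rfl⟩
    rw [Set.compl_prod_eq_union]
    refine (measure_union_le _ _).trans ?_
    rw [Set.prod_univ, Set.univ_prod, ← Measure.map_apply measurable_fst hK.measurableSet.compl,
      ← Measure.map_apply measurable_snd hL.measurableSet.compl, (h n).1, (h n).2]
    exact (add_le_add (hKμ μ rfl) (hLν ν rfl)).trans (ENNReal.add_halves ε).le
  have hc := isCompact_closure_of_isTightMeasureSet htight
  obtain ⟨ρ, -, hρ⟩ := hc.ultrafilter_le_nhds (U.map π)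
    (by
      rw [le_principal_iff, Ultrafilter.coe_map, mem_map]
      exact Filter.univ_mem' fun n => subset_closure ⟨n, rfl⟩)
  have hρ' : Tendsto π U (𝓝 ρ) := hρ
  refine ⟨ρ, ?_, hρ'⟩
  let μ' : ProbabilityMeasure (Space d) := ⟨μ, inferInstance⟩
  let ν' : ProbabilityMeasure (Space d) := ⟨ν, inferInstance⟩
  constructor
  · have h1 : Tendsto (fun n => (π n).map measurable_fst.aemeasurable) U
        (𝓝 (ρ.map measurable_fst.aemeasurable)) :=
      ((ProbabilityMeasure.continuous_map (continuous_fst (X := Space d)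
        (Y := Space d))).tendsto ρ).comp hρ'
    have he : (fun n => (π n).map measurable_fst.aemeasurable) = fun _ => μ' :=
      funext fun n => Subtype.ext (h n).1
    rw [he] at h1
    have he' := tendsto_nhds_unique h1 tendsto_const_nhds
    exact congrArg Subtype.val he'
  · have h1 : Tendsto (fun n => (π n).map measurable_snd.aemeasurable) U
        (𝓝 (ρ.map measurable_snd.aemeasurable)) :=
      ((ProbabilityMeasure.continuous_map (continuous_snd (X := Space d)
        (Y := Space d))).tendsto ρ).comp hρ'
    have he : (fun n => (π n).map measurable_snd.aemeasurable) = fun _ => ν' :=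
      funext fun n => Subtype.ext (h n).2
    rw [he] at h1
    have he' := tendsto_nhds_unique h1 tendsto_const_nhds
    exact congrArg Subtype.val he'

/-- Cauchy–Schwarz; the point is that the bound depends on the marginals only, hence is uniform over
couplings. -/
lemma couplings.abs_integral_inner_le {f g : Space d → Space d} (h : π ∈ couplings μ ν)
    (hf : MemLp f 2 μ) (hg : MemLp g 2 ν) :
    |∫ p, ⟪f p.1, g p.2⟫ ∂π| ≤ (eLpNorm f 2 μ).toReal * (eLpNorm g 2 ν).toReal := by
  have hf' := couplings.memLp_fst h hf
  have hg' := couplings.memLp_snd h hg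
  have e1 : eLpNorm (fun p => f p.1) 2 π = eLpNorm f 2 μ :=
    eLpNorm_comp_measurePreserving hf.1 (couplings.measurePreserving_fst h)
  have e2 : eLpNorm (fun p => g p.2) 2 π = eLpNorm g 2 ν :=
    eLpNorm_comp_measurePreserving hg.1 (couplings.measurePreserving_snd h)
  rw [← inner_toLp hf' hg']
  refine (abs_real_inner_le_norm _ _).trans ?_
  rw [Lp.norm_toLp, Lp.norm_toLp, e1, e2]

end

/-! ### Limits of correlations and existence of optimal couplings -/

section

variable {d : ℕ} {μ ν η : Measure (Space d)} {π : Measure (Space d × Space d)}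

/-- One approximation serves all couplings at once: `f` is replaced first, at a cost weighted by the
norm of `g`, then `g`, at a cost weighted by the norm of the already chosen `f'`. -/
lemma exists_boundedContinuous_integral_inner_sub_le [IsProbabilityMeasure μ]
    [IsProbabilityMeasure ν] {f g : Space d → Space d} (hf : MemLp f 2 μ) (hg : MemLp g 2 ν)
    {ε : ℝ} (hε : 0 < ε) :
    ∃ f' g' : BoundedContinuousFunction (Space d) (Space d), ∀ π ∈ couplings μ ν,
      |∫ p, ⟪f p.1, g p.2⟫ ∂π - ∫ p, ⟪f' p.1, g' p.2⟫ ∂π| ≤ ε := by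
  set a := (eLpNorm g 2 ν).toReal
  have ha : 0 ≤ a := ENNReal.toReal_nonneg
  -- Adding 1 in the denominator covers the case where the norm vanishes.
  obtain ⟨f', hf'1, hf'2⟩ := hf.exists_boundedContinuous_eLpNorm_sub_le (by simp)
    (ε := ENNReal.ofReal (ε / 2 / (a + 1))) (by
      rw [Ne, ENNReal.ofReal_eq_zero, not_le]; positivity)
  set b := (eLpNorm f' 2 μ).toReal
  have hb : 0 ≤ b := ENNReal.toReal_nonneg
  obtain ⟨g', hg'1, hg'2⟩ := hg.exists_boundedContinuous_eLpNorm_sub_le (by simp)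
    (ε := ENNReal.ofReal (ε / 2 / (b + 1))) (by
      rw [Ne, ENNReal.ofReal_eq_zero, not_le]; positivity)
  refine ⟨f', g', fun π h => ?_⟩
  have h1 := couplings.abs_integral_inner_le h (hf.sub hf'2) hg
  have h2 := couplings.abs_integral_inner_le h hf'2 (hg.sub hg'2)
  have e1 : (eLpNorm (f - ⇑f') 2 μ).toReal ≤ ε / 2 / (a + 1) :=
    ENNReal.toReal_le_of_le_ofReal (by positivity) hf'1
  have e2 : (eLpNorm (g - ⇑g') 2 ν).toReal ≤ ε / 2 / (b + 1) :=
    ENNReal.toReal_le_of_le_ofReal (by positivity) hg'1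
  have i1 := couplings.integrable_inner h (hf.sub hf'2) hg
  have i2 := couplings.integrable_inner h hf'2 (hg.sub hg'2)
  have i3 := couplings.integrable_inner h hf hg
  have i4 := couplings.integrable_inner h hf'2 hg'2
  have key : ∫ p, ⟪f p.1, g p.2⟫ ∂π - ∫ p, ⟪f' p.1, g' p.2⟫ ∂π
      = ∫ p, ⟪(f - ⇑f') p.1, g p.2⟫ ∂π + ∫ p, ⟪f' p.1, (g - ⇑g') p.2⟫ ∂π := by
    rw [← integral_sub i3 i4, ← integral_add i1 i2]
    congr 1 with p
    simp only [Pi.sub_apply, inner_sub_left, inner_sub_right]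
    ring
  rw [key]
  have h3 : (eLpNorm (f - ⇑f') 2 μ).toReal * a ≤ ε / 2 := by
    calc _ ≤ ε / 2 / (a + 1) * a := by gcongr
      _ ≤ ε / 2 / (a + 1) * (a + 1) := by gcongr; linarith
      _ = ε / 2 := by field_simp
  have h4 : b * (eLpNorm (g - ⇑g') 2 ν).toReal ≤ ε / 2 := by
    calc _ ≤ b * (ε / 2 / (b + 1)) := by gcongr
      _ ≤ (b + 1) * (ε / 2 / (b + 1)) := by gcongr; linarith
      _ = ε / 2 := by field_simp
  calc _ ≤ _ := abs_add_le _ _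
    _ ≤ ε / 2 + ε / 2 := add_le_add (h1.trans h3) (h2.trans h4)
    _ = ε := by ring

/-- Weak convergence tests only bounded continuous integrands, but with fixed marginals the uniform
approximation extends it to products of `L²` functions, which may be unbounded and discontinuous. -/
lemma tendsto_integral_inner_of_couplings [IsProbabilityMeasure μ] [IsProbabilityMeasure ν]
    {l : Filter ℕ} {π : ℕ → ProbabilityMeasure (Space d × Space d)}
    {ρ : ProbabilityMeasure (Space d × Space d)}
    (hπ : ∀ n, (π n : Measure (Space d × Space d)) ∈ couplings μ ν)
    (hρ : (ρ : Measure (Space d × Space d)) ∈ couplings μ ν) (h : Tendsto π l (𝓝 ρ))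
    {f g : Space d → Space d} (hf : MemLp f 2 μ) (hg : MemLp g 2 ν) :
    Tendsto (fun n => ∫ p, ⟪f p.1, g p.2⟫ ∂(π n : Measure (Space d × Space d))) l
      (𝓝 (∫ p, ⟪f p.1, g p.2⟫ ∂(ρ : Measure (Space d × Space d)))) := by
  rw [Metric.tendsto_nhds]
  intro ε hε
  obtain ⟨f', g', hfg⟩ := exists_boundedContinuous_integral_inner_sub_le hf hg
    (show 0 < ε / 4 by positivity)
  let F : BoundedContinuousFunction (Space d × Space d) ℝ :=
    BoundedContinuousFunction.ofNormedAddCommGroup (fun p => ⟪f' p.1, g' p.2⟫) (by fun_prop)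
      (‖f'‖ * ‖g'‖) (fun p => (norm_inner_le_norm _ _).trans (by
        gcongr
        · exact f'.norm_coe_le_norm _
        · exact g'.norm_coe_le_norm _))
  have hF := (ProbabilityMeasure.tendsto_iff_forall_integral_tendsto.1 h) F
  filter_upwards [(Metric.tendsto_nhds.1 hF) (ε / 4) (by positivity)] with n hn
  have h1 := hfg _ (hπ n)
  have h2 := hfg _ hρ
  rw [Real.dist_eq] at hn ⊢
  change |∫ p, ⟪f' p.1, g' p.2⟫ ∂(π n : Measure (Space d × Space d)) -
    ∫ p, ⟪f' p.1, g' p.2⟫ ∂(ρ : Measure (Space d × Space d))| < _ at hn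
  rw [abs_le] at h1 h2
  rw [abs_lt] at hn ⊢
  constructor <;> linarith [h1.1, h1.2, h2.1, h2.2, hn.1, hn.2]

/-- A single ultrafilter, chosen before `f` and `g`, replaces the extraction of a subsequence. -/
lemma exists_limit_coupling [IsProbabilityMeasure μ] [IsProbabilityMeasure ν]
    {π : ℕ → Measure (Space d × Space d)} (h : ∀ n, π n ∈ couplings μ ν) :
    ∃ U : Ultrafilter ℕ, (U : Filter ℕ) ≤ atTop ∧ ∃ ρ ∈ couplings μ ν,
      ∀ f g : Space d → Space d, MemLp f 2 μ → MemLp g 2 ν →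
        Tendsto (fun n => ∫ p, ⟪f p.1, g p.2⟫ ∂(π n)) U (𝓝 (∫ p, ⟪f p.1, g p.2⟫ ∂ρ)) := by
  let π' : ℕ → ProbabilityMeasure (Space d × Space d) :=
    fun n => ⟨π n, couplings.isProbabilityMeasure (h n)⟩
  obtain ⟨ρ, hρ, hlim⟩ := exists_tendsto_coupling (μ := μ) (ν := ν) (hyperfilter ℕ) π' h
  refine ⟨hyperfilter ℕ, Nat.hyperfilter_le_atTop, ρ, hρ, fun f g hf hg => ?_⟩
  exact tendsto_integral_inner_of_couplings (π := π') h hρ hlim hf hg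

lemma optCouplings_nonempty (hμ : μ ∈ P2 d) (hν : ν ∈ P2 d) : (optCouplings μ ν).Nonempty := by
  have := isProbabilityMeasure_of_mem_P2 hμ
  have := isProbabilityMeasure_of_mem_P2 hν
  have hne : (corr '' couplings μ ν).Nonempty := ⟨_, _, prod_mem_couplings, rfl⟩
  have hbdd : BddAbove (corr '' couplings μ ν) := by
    refine ⟨(secondMoment μ + secondMoment ν) / 2, ?_⟩
    rintro _ ⟨π, h, rfl⟩
    linarith [(quadCost_eq hμ hν h).2]
  obtain ⟨u, -, hu, hmem⟩ := exists_seq_tendsto_sSup hne hbdd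
  choose π hπ hπu using hmem
  obtain ⟨U, hU, ρ, hρ, hlim⟩ := exists_limit_coupling hπ
  refine ⟨ρ, (mem_optCouplings_iff hμ hν).2 ⟨hρ, fun π' h' => ?_⟩⟩
  have h1 : Tendsto (fun n => corr (π n)) U (𝓝 (corr ρ)) :=
    hlim id id (memLp_id_of_mem_P2 hμ) (memLp_id_of_mem_P2 hν)
  simp only [hπu] at h1
  rw [← tendsto_nhds_unique (hu.mono_left hU) h1]
  exact le_csSup hbdd ⟨π', h', rfl⟩

end

/-! ### Barycentric projections as a closed convex subset of `L²(μ)` -/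

section

variable {d : ℕ} {μ ν η : Measure (Space d)} {π : Measure (Space d × Space d)}

lemma couplings.integrable_inner_snd {f : Space d → Space d} (h : π ∈ couplings μ ν)
    (hf : MemLp f 2 μ) (hν : MemLp id 2 ν) : Integrable (fun p => ⟪f p.1, p.2⟫) π := by
  simpa only [id_eq] using couplings.integrable_inner (g := id) h hf hν

/-- The barycenters `∫ y k(x, dy)` of a kernel. -/
def kernelMean (k : Kernel (Space d) (Space d)) (x : Space d) : Space d := ∫ y, y ∂(k x)

lemma stronglyMeasurable_kernelMean (k : Kernel (Space d) (Space d)) [IsSFiniteKernel k] :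
    StronglyMeasurable (kernelMean k) :=
  StronglyMeasurable.integral_kernel (κ := k) stronglyMeasurable_id

lemma exists_kernel_of_mem_couplings [IsProbabilityMeasure μ] (h : π ∈ couplings μ ν) :
    ∃ k : Kernel (Space d) (Space d), IsMarkovKernel k ∧ μ ⊗ₘ k = π := by
  have := couplings.isProbabilityMeasure h
  refine ⟨π.condKernel, inferInstance, ?_⟩
  have h1 : π.fst = μ := h.1
  rw [← h1]
  exact π.disintegrate π.condKernel

section Kernel

variable {k : Kernel (Space d) (Space d)} [IsMarkovKernel k]

lemma ae_integrable_of_compProd_mem_couplings [IsProbabilityMeasure μ]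
    (h : μ ⊗ₘ k ∈ couplings μ ν) {F : Type*} [NormedAddCommGroup F] {f : Space d → F}
    (hf : Integrable f ν) : ∀ᵐ x ∂μ, Integrable f (k x) := by
  have hi : Integrable (fun p : Space d × Space d => f p.2) (μ ⊗ₘ k) :=
    (couplings.measurePreserving_snd h).integrable_comp_of_integrable hf
  exact ((Measure.integrable_compProd_iff hi.1).1 hi).1

lemma integral_integral_of_compProd_mem_couplings [IsProbabilityMeasure μ]
    (h : μ ⊗ₘ k ∈ couplings μ ν) {f : Space d → ℝ} (hf : Integrable f ν) :
    Integrable (fun x => ∫ y, f y ∂(k x)) μ ∧ ∫ x, ∫ y, f y ∂(k x) ∂μ = ∫ y, f y ∂ν := by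
  have hi : Integrable (fun p : Space d × Space d => f p.2) (μ ⊗ₘ k) :=
    (couplings.measurePreserving_snd h).integrable_comp_of_integrable hf
  have e : ∫ y, f y ∂ν = ∫ p, f p.2 ∂(μ ⊗ₘ k) := by
    have hf' := hf.1
    rw [← h.2] at hf' ⊢
    exact integral_map measurable_snd.aemeasurable hf'
  refine ⟨hi.integral_compProd, ?_⟩
  rw [e, Measure.integral_compProd hi]

/-- The squared norm of a mean is at most the mean of the squared norm, and integrating the latter
gives the second moment of `ν`. -/
lemma memLp_kernelMean [IsProbabilityMeasure μ] (hν : MemLp id 2 ν)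
    (h : μ ⊗ₘ k ∈ couplings μ ν) : MemLp (kernelMean k) 2 μ := by
  refine ⟨(stronglyMeasurable_kernelMean k).aestronglyMeasurable, ?_⟩
  rw [eLpNorm_two_lt_top_iff]
  calc ∫⁻ x, ‖kernelMean k x‖ₑ ^ 2 ∂μ ≤ ∫⁻ x, ∫⁻ y, ‖y‖ₑ ^ 2 ∂(k x) ∂μ := by
        refine lintegral_mono fun x => ?_
        have h1 : ‖kernelMean k x‖ₑ ≤ eLpNorm id 1 (k x) := by
          rw [eLpNorm_one_eq_lintegral_enorm]
          exact enorm_integral_le_lintegral_enorm _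
        have h2 : eLpNorm (id : Space d → Space d) 1 (k x) ≤ eLpNorm id 2 (k x) :=
          eLpNorm_le_eLpNorm_of_exponent_le (by norm_num) aestronglyMeasurable_id
        have h3 : eLpNorm (id : Space d → Space d) 2 (k x) ^ 2 = ∫⁻ y, ‖y‖ₑ ^ 2 ∂(k x) := by
          rw [eLpNorm_eq_lintegral_rpow_enorm_toReal (by simp) (by simp), ← ENNReal.rpow_natCast,
            ← ENNReal.rpow_mul]
          simp
        rw [← h3]
        gcongr
        exact h1.trans h2
    _ = ∫⁻ p, ‖p.2‖ₑ ^ 2 ∂(μ ⊗ₘ k) := by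
        rw [Measure.lintegral_compProd (by fun_prop)]
    _ = ∫⁻ y, ‖y‖ₑ ^ 2 ∂ν := by
        rw [← h.2, lintegral_map (by fun_prop) measurable_snd]
    _ < ⊤ := eLpNorm_two_lt_top_iff.1 hν.2

lemma integral_inner_kernelMean [IsProbabilityMeasure μ] (hν : MemLp id 2 ν)
    [IsProbabilityMeasure ν] (h : μ ⊗ₘ k ∈ couplings μ ν) {f : Space d → Space d}
    (hf : MemLp f 2 μ) :
    ∫ p, ⟪f p.1, p.2⟫ ∂(μ ⊗ₘ k) = ∫ x, ⟪f x, kernelMean k x⟫ ∂μ := by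
  have hi : Integrable (fun p => ⟪f p.1, p.2⟫) (μ ⊗ₘ k) := couplings.integrable_inner_snd h hf hν
  rw [Measure.integral_compProd hi]
  refine integral_congr_ae ?_
  filter_upwards [ae_integrable_of_compProd_mem_couplings h (hν.integrable (by norm_num))]
    with x hx
  exact integral_inner hx (f x)

end Kernel

/-- `T` is the barycentric projection of the coupling `π` of `μ` with another measure. -/
def IsBarycenter (μ : Measure (Space d)) (π : Measure (Space d × Space d))
    (T : Space d → Space d) : Prop :=
  ∀ f : Space d → Space d, MemLp f 2 μ → ∫ p, ⟪f p.1, p.2⟫ ∂π = ∫ x, ⟪f x, T x⟫ ∂μ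

/-- The barycentric projections of the couplings of `μ` and `ν`. -/
def baryLp (μ ν : Measure (Space d)) : Set (Lp (Space d) 2 μ) :=
  {T | ∃ π ∈ couplings μ ν, IsBarycenter μ π T}

lemma IsBarycenter.congr {T S : Space d → Space d} (h : IsBarycenter μ π T) (hTS : T =ᵐ[μ] S) :
    IsBarycenter μ π S := fun f hf => by
  rw [h f hf]
  refine integral_congr_ae ?_
  filter_upwards [hTS] with x hx
  rw [hx]

lemma ae_eq_of_forall_integral_inner_eq {T S : Space d → Space d} (hT : MemLp T 2 μ)
    (hS : MemLp S 2 μ)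
    (h : ∀ f : Space d → Space d, MemLp f 2 μ → ∫ x, ⟪f x, T x⟫ ∂μ = ∫ x, ⟪f x, S x⟫ ∂μ) :
    T =ᵐ[μ] S := by
  rw [← MemLp.toLp_eq_toLp_iff hT hS]
  refine ext_inner_left ℝ fun f => ?_
  have e : f = (Lp.memLp f).toLp f := (Lp.toLp_coeFn f _).symm
  rw [e, inner_toLp, inner_toLp]
  exact h f (Lp.memLp f)

lemma toLp_kernelMean_mem_baryLp [IsProbabilityMeasure μ] [IsProbabilityMeasure ν]
    (hν : MemLp id 2 ν) {k : Kernel (Space d) (Space d)} [IsMarkovKernel k]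
    (h : μ ⊗ₘ k ∈ couplings μ ν) : (memLp_kernelMean hν h).toLp _ ∈ baryLp μ ν := by
  refine ⟨μ ⊗ₘ k, h, ?_⟩
  refine IsBarycenter.congr (T := kernelMean k) ?_ (memLp_kernelMean hν h).coeFn_toLp.symm
  exact fun f hf => integral_inner_kernelMean hν h hf

lemma exists_kernel_of_isBarycenter [IsProbabilityMeasure μ] [IsProbabilityMeasure ν]
    (hν : MemLp id 2 ν) (h : π ∈ couplings μ ν) {T : Space d → Space d} (hTm : MemLp T 2 μ)
    (hT : IsBarycenter μ π T) :
    ∃ k : Kernel (Space d) (Space d), IsMarkovKernel k ∧ μ ⊗ₘ k = π ∧ T =ᵐ[μ] kernelMean k := by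
  obtain ⟨k, hk, rfl⟩ := exists_kernel_of_mem_couplings h
  refine ⟨k, hk, rfl, ae_eq_of_forall_integral_inner_eq hTm (memLp_kernelMean hν h) ?_⟩
  intro f hf
  rw [← hT f hf, integral_inner_kernelMean hν h hf]

/-- The defining identity of the barycentric projection is linear in the coupling. -/
lemma convex_baryLp [IsProbabilityMeasure μ] [IsProbabilityMeasure ν] (hν : MemLp id 2 ν) :
    Convex ℝ (baryLp μ ν) := by
  rintro T ⟨π, h, hT⟩ S ⟨π', h', hS⟩ a b ha hb hab
  refine ⟨ENNReal.ofReal a • π + ENNReal.ofReal b • π', smul_add_smul_mem_couplings h h' ?_, ?_⟩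
  · rw [← ENNReal.ofReal_add ha hb, hab, ENNReal.ofReal_one]
  · have hc : IsBarycenter μ (ENNReal.ofReal a • π + ENNReal.ofReal b • π')
        (fun x => a • T x + b • S x) := by
      intro f hf
      have i1 : Integrable (fun p => ⟪f p.1, p.2⟫) π := couplings.integrable_inner_snd h hf hν
      have i2 : Integrable (fun p => ⟪f p.1, p.2⟫) π' := couplings.integrable_inner_snd h' hf hν
      rw [integral_add_measure (i1.smul_measure ENNReal.ofReal_ne_top)
        (i2.smul_measure ENNReal.ofReal_ne_top), integral_smul_measure, integral_smul_measure, ENNReal.toReal_ofReal ha,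
        ENNReal.toReal_ofReal hb]
      change a • ∫ p, ⟪f p.1, p.2⟫ ∂π + b • ∫ p, ⟪f p.1, p.2⟫ ∂π' = _
      rw [hT f hf, hS f hf]
      simp only [inner_add_right, inner_smul_right, smul_eq_mul]
      rw [integral_add ((integrable_inner_of_memLp hf (Lp.memLp T)).const_mul a)
        ((integrable_inner_of_memLp hf (Lp.memLp S)).const_mul b), integral_const_mul,
        integral_const_mul]
    refine hc.congr ?_
    filter_upwards [Lp.coeFn_add (a • T) (b • S), Lp.coeFn_smul a T, Lp.coeFn_smul b S]
      with x h1 h2 h3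
    rw [h1, Pi.add_apply, h2, h3]
    rfl

/-- A limit coupling has the right projection: the pairings with a fixed `f` converge on the one
side along the ultrafilter of couplings, on the other by convergence in `L²`. -/
lemma isClosed_baryLp [IsProbabilityMeasure μ] [IsProbabilityMeasure ν] (hν : MemLp id 2 ν) :
    IsClosed (baryLp μ ν) := by
  refine IsSeqClosed.isClosed ?_
  intro T S hT hS
  choose π hπ hbar using hT
  obtain ⟨U, hU, ρ, hρ, hlim⟩ := exists_limit_coupling hπ
  refine ⟨ρ, hρ, fun f hf => ?_⟩
  have h1 := hlim f id hf hν
  have h2 : Tendsto (fun n => ⟪hf.toLp f, T n⟫) U (𝓝 ⟪hf.toLp f, S⟫) :=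
    (tendsto_const_nhds.inner hS).mono_left hU
  have e : ∀ R : Lp (Space d) 2 μ, ⟪hf.toLp f, R⟫ = ∫ x, ⟪f x, R x⟫ ∂μ := fun R => by
    conv_lhs => rw [← Lp.toLp_coeFn R (Lp.memLp R)]
    rw [inner_toLp]
  simp only [e, ← hbar _ f hf] at h2
  exact tendsto_nhds_unique h1 h2

end

/-! ### Convex order and Jensen's inequality -/

section

variable {d : ℕ} {μ ν η : Measure (Space d)} {π : Measure (Space d × Space d)}
  {φ : Space d → ℝ}

lemma continuous_of_convexOn (hφ : ConvexOn ℝ Set.univ φ) : Continuous φ :=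
  hφ.locallyLipschitz.continuous

lemma exists_affine_le (hφ : ConvexOn ℝ Set.univ φ) :
    ∃ (l : Space d →L[ℝ] ℝ) (c : ℝ), ∀ x, l x + c ≤ φ x := by
  obtain ⟨l, c, h, -⟩ := ConvexOn.exists_affine_le_of_lt (𝕜 := ℝ) (Set.mem_univ 0)
    (sub_one_lt (φ 0)) isClosed_univ
    ((continuous_of_convexOn hφ).lowerSemicontinuous.lowerSemicontinuousOn _) hφ
  exact ⟨l, c, fun x => h ⟨x, Set.mem_univ x⟩⟩

lemma integrable_affine {α : Type*} [MeasurableSpace α] {ρ : Measure α} [IsFiniteMeasure ρ]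
    {T : α → Space d} (hT : MemLp T 2 ρ) (l : Space d →L[ℝ] ℝ) (c : ℝ) :
    Integrable (fun x => l (T x) + c) ρ :=
  (l.integrable_comp (hT.integrable (by norm_num))).add (integrable_const c)

/-- An affine minorant of `φ` is integrable against a measure of `P2 d`, so only the positive part
can have infinite integral. -/
lemma lintegral_ofReal_neg_ne_top (hφ : ConvexOn ℝ Set.univ φ) (hη : η ∈ P2 d) :
    ∫⁻ x, ENNReal.ofReal (-φ x) ∂η ≠ ⊤ := by
  have := isProbabilityMeasure_of_mem_P2 hη
  obtain ⟨l, c, h⟩ := exists_affine_le hφ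
  have hi := (integrable_affine (memLp_id_of_mem_P2 hη) l c).neg
  refine ne_top_of_le_ne_top hi.lintegral_lt_top.ne (lintegral_mono fun x => ?_)
  exact ENNReal.ofReal_le_ofReal (neg_le_neg (h x))

lemma integrable_of_lintegral_ofReal_ne_top (hφ : ConvexOn ℝ Set.univ φ) (hη : η ∈ P2 d)
    (h : ∫⁻ x, ENNReal.ofReal (φ x) ∂η ≠ ⊤) : Integrable φ η := by
  refine ⟨(continuous_of_convexOn hφ).aestronglyMeasurable, ?_⟩
  have h1 := lintegral_ofReal_neg_ne_top hφ hη
  refine lt_of_le_of_lt (lintegral_mono (g := fun x => ENNReal.ofReal (φ x) +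
    ENNReal.ofReal (-φ x)) fun x => ?_) ?_
  · rw [Real.enorm_eq_ofReal_abs]
    rcases abs_cases (φ x) with ⟨e, -⟩ | ⟨e, -⟩ <;> rw [e] <;> simp
  · rw [lintegral_add_left ((continuous_of_convexOn hφ).measurable.ennreal_ofReal)]
    exact ENNReal.add_lt_top.2 ⟨h.lt_top, h1.lt_top⟩

lemma integralMakesSense_of_convexOn (hφ : ConvexOn ℝ Set.univ φ) (hη : η ∈ P2 d) :
    IntegralMakesSense φ η := Or.inr (lintegral_ofReal_neg_ne_top hφ hη)

lemma extIntegral_of_integrable (h : Integrable φ η) : extIntegral φ η = (∫ x, φ x ∂η : ℝ) := by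
  have h1 := h.lintegral_lt_top.ne
  have h2 : ∫⁻ x, ENNReal.ofReal (-φ x) ∂η ≠ ⊤ := h.neg.lintegral_lt_top.ne
  rw [integral_eq_lintegral_pos_part_sub_lintegral_neg_part h, extIntegral, EReal.coe_sub,
    EReal.coe_ennreal_toReal h1, EReal.coe_ennreal_toReal h2]

lemma extIntegral_eq_top (hφ : ConvexOn ℝ Set.univ φ) (hη : η ∈ P2 d) (h : ¬ Integrable φ η) :
    extIntegral φ η = ⊤ := by
  have h1 : ∫⁻ x, ENNReal.ofReal (φ x) ∂η = ⊤ := by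
    by_contra h1
    exact h (integrable_of_lintegral_ofReal_ne_top hφ hη h1)
  rw [extIntegral, h1, ← EReal.coe_ennreal_toReal (lintegral_ofReal_neg_ne_top hφ hη)]
  rfl

lemma integrable_of_extIntegral_lt_top (hφ : ConvexOn ℝ Set.univ φ) (hη : η ∈ P2 d)
    (h : extIntegral φ η < ⊤) : Integrable φ η := by
  by_contra h1
  exact h.ne (extIntegral_eq_top hφ hη h1)

/-- Since negative parts are always integrable here, every extended integral makes sense, and a
convex function that is not `ν`-integrable imposes no condition. -/
lemma convexOrder_iff (hη : η ∈ P2 d) (hν : ν ∈ P2 d) :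
    ConvexOrder η ν ↔ ∀ φ : Space d → ℝ, ConvexOn ℝ Set.univ φ → Integrable φ ν →
      Integrable φ η ∧ ∫ x, φ x ∂η ≤ ∫ x, φ x ∂ν := by
  constructor
  · intro h φ hφ hi
    have h1 := h φ hφ (integralMakesSense_of_convexOn hφ hη) (integralMakesSense_of_convexOn hφ hν)
    rw [extIntegral_of_integrable hi] at h1
    have h2 := integrable_of_extIntegral_lt_top hφ hη (h1.trans_lt (EReal.coe_lt_top _))
    rw [extIntegral_of_integrable h2] at h1
    exact ⟨h2, EReal.coe_le_coe_iff.1 h1⟩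
  · intro h φ hφ _ _
    by_cases hi : Integrable φ ν
    · obtain ⟨h1, h2⟩ := h φ hφ hi
      rw [extIntegral_of_integrable hi, extIntegral_of_integrable h1]
      exact EReal.coe_le_coe_iff.2 h2
    · rw [extIntegral_eq_top hφ hν hi]
      exact le_top

lemma ConvexOrder.trans {ρ : Measure (Space d)} (hη : η ∈ P2 d) (hν : ν ∈ P2 d) (hρ : ρ ∈ P2 d)
    (h1 : ConvexOrder η ν) (h2 : ConvexOrder ν ρ) : ConvexOrder η ρ := by
  rw [convexOrder_iff hη hρ]
  rw [convexOrder_iff hη hν] at h1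
  rw [convexOrder_iff hν hρ] at h2
  intro φ hφ hi
  obtain ⟨h3, h4⟩ := h2 φ hφ hi
  obtain ⟨h5, h6⟩ := h1 φ hφ h3
  exact ⟨h5, h6.trans h4⟩

section Jensen

variable {k : Kernel (Space d) (Space d)} [IsMarkovKernel k]

lemma ae_map_kernelMean_le [IsProbabilityMeasure μ] (hν : ν ∈ P2 d)
    (h : μ ⊗ₘ k ∈ couplings μ ν) (hφ : ConvexOn ℝ Set.univ φ) (hi : Integrable φ ν) :
    ∀ᵐ x ∂μ, φ (kernelMean k x) ≤ ∫ y, φ y ∂(k x) := by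
  have := isProbabilityMeasure_of_mem_P2 hν
  filter_upwards [ae_integrable_of_compProd_mem_couplings h
    ((memLp_id_of_mem_P2 hν).integrable (by norm_num)),
    ae_integrable_of_compProd_mem_couplings h hi] with x h1 h2
  exact hφ.map_integral_le (continuous_of_convexOn hφ).continuousOn isClosed_univ (by simp) h1 h2

lemma integrable_comp_of_le_of_affine [IsFiniteMeasure μ] {T : Space d → Space d}
    (hT : MemLp T 2 μ) (hφ : ConvexOn ℝ Set.univ φ) {g : Space d → ℝ} (hg : Integrable g μ)
    (h : ∀ᵐ x ∂μ, φ (T x) ≤ g x) : Integrable (fun x => φ (T x)) μ := by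
  obtain ⟨l, c, hl⟩ := exists_affine_le hφ
  exact integrable_of_le_of_le
    ((continuous_of_convexOn hφ).comp_aestronglyMeasurable hT.1)
    (ae_of_all _ fun x => hl (T x)) h (integrable_affine hT l c) hg

lemma integral_map_kernelMean_le [IsProbabilityMeasure μ] (hν : ν ∈ P2 d)
    (h : μ ⊗ₘ k ∈ couplings μ ν) (hφ : ConvexOn ℝ Set.univ φ) (hi : Integrable φ ν) :
    Integrable (fun x => φ (kernelMean k x)) μ ∧
      ∫ x, φ (kernelMean k x) ∂μ ≤ ∫ y, φ y ∂ν := by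
  have h1 := ae_map_kernelMean_le hν h hφ hi
  obtain ⟨h2, h3⟩ := integral_integral_of_compProd_mem_couplings h hi
  have h4 := integrable_comp_of_le_of_affine (memLp_kernelMean (memLp_id_of_mem_P2 hν) h) hφ h2 h1
  exact ⟨h4, h3 ▸ integral_mono_ae h4 h2 h1⟩

/-- The case of equality in Jensen's inequality: the coupling is carried by a graph. -/
lemma eq_map_graph_kernelMean [IsProbabilityMeasure μ] (hν : ν ∈ P2 d)
    (h : μ ⊗ₘ k ∈ couplings μ ν) (hφ : StrictConvexOn ℝ Set.univ φ) (hi : Integrable φ ν)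
    (heq : ∫ y, φ y ∂ν ≤ ∫ x, φ (kernelMean k x) ∂μ) :
    μ ⊗ₘ k = μ.map (fun x => (x, kernelMean k x)) := by
  have := isProbabilityMeasure_of_mem_P2 hν
  have h1 := ae_map_kernelMean_le hν h hφ.convexOn hi
  obtain ⟨h2, h3⟩ := integral_integral_of_compProd_mem_couplings h hi
  obtain ⟨h4, h5⟩ := integral_map_kernelMean_le hν h hφ.convexOn hi
  -- Integrated equality forces equality in Jensen for almost every `x`, and strict convexity then
  -- makes `k x` a Dirac mass.
  have h6 : (fun x => φ (kernelMean k x)) =ᵐ[μ] fun x => ∫ y, φ y ∂(k x) :=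
    (integral_eq_iff_of_ae_le h4 h2 h1).1 (by rw [h3]; exact le_antisymm h5 heq)
  have h7 : ∀ᵐ x ∂μ, ∀ᵐ y ∂(k x), y = kernelMean k x := by
    filter_upwards [h6, ae_integrable_of_compProd_mem_couplings h
      ((memLp_id_of_mem_P2 hν).integrable (by norm_num)),
      ae_integrable_of_compProd_mem_couplings h hi] with x h6 h8 h9
    rcases hφ.ae_eq_const_or_map_average_lt (continuous_of_convexOn hφ.convexOn).continuousOn
      isClosed_univ (by simp) h8 h9 with h10 | h10
    · rw [average_eq_integral] at h10
      exact h10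
    · rw [average_eq_integral, average_eq_integral] at h10
      exact absurd h6 h10.ne
  have hm := (stronglyMeasurable_kernelMean k).measurable
  have h8 : ∀ᵐ p ∂(μ ⊗ₘ k), p = (p.1, kernelMean k p.1) := by
    refine Measure.ae_compProd_of_ae_ae (measurableSet_eq_fun measurable_id (by fun_prop)) ?_
    filter_upwards [h7] with x hx
    filter_upwards [hx] with y hy
    simp [hy]
  calc μ ⊗ₘ k = (μ ⊗ₘ k).map id := Measure.map_id.symm
    _ = (μ ⊗ₘ k).map (fun p => (p.1, kernelMean k p.1)) := Measure.map_congr h8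
    _ = ((μ ⊗ₘ k).map Prod.fst).map (fun x => (x, kernelMean k x)) := by
      rw [Measure.map_map (by fun_prop) measurable_fst]
      rfl
    _ = _ := by rw [h.1]

end Jensen

lemma integrable_map_iff_and_integral {T : Space d → Space d} (hT : AEMeasurable T μ)
    (hφ : ConvexOn ℝ Set.univ φ) :
    (Integrable φ (μ.map T) ↔ Integrable (fun x => φ (T x)) μ) ∧
      ∫ y, φ y ∂(μ.map T) = ∫ x, φ (T x) ∂μ :=
  ⟨integrable_map_measure (continuous_of_convexOn hφ).aestronglyMeasurable hT,
    integral_map hT (continuous_of_convexOn hφ).aestronglyMeasurable⟩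

/-- The easy half of Strassen's theorem: Jensen conditionally on `x`. -/
lemma convexOrder_map_of_isBarycenter [IsProbabilityMeasure μ] (hν : ν ∈ P2 d)
    (h : π ∈ couplings μ ν) {T : Space d → Space d} (hTm : MemLp T 2 μ)
    (hT : IsBarycenter μ π T) : ConvexOrder (μ.map T) ν := by
  have := isProbabilityMeasure_of_mem_P2 hν
  obtain ⟨k, _, rfl, hk⟩ := exists_kernel_of_isBarycenter (memLp_id_of_mem_P2 hν) h hTm hT
  rw [convexOrder_iff (map_mem_P2 hTm) hν]
  intro φ hφ hi
  rw [Measure.map_congr hk]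
  have hm := (stronglyMeasurable_kernelMean k).aestronglyMeasurable.aemeasurable (μ := μ)
  rw [(integrable_map_iff_and_integral hm hφ).1, (integrable_map_iff_and_integral hm hφ).2]
  exact integral_map_kernelMean_le hν h hφ hi

end

/-! ### Linear functionals dominated by the integral of a finite maximum -/

section

section Sublinear

variable {α : Type*} [MeasurableSpace α] {ρ : Measure α} {ι : Type*} [Fintype ι] [Nonempty ι]

lemma iSup_add_le_of_finite (f g : ι → ℝ) : ⨆ i, (f i + g i) ≤ (⨆ i, f i) + ⨆ i, g i :=
  ciSup_le fun i => add_le_add (le_ciSup (Set.finite_range f).bddAbove i)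
    (le_ciSup (Set.finite_range g).bddAbove i)

lemma abs_iSup_le_sum (f : ι → ℝ) : |⨆ i, f i| ≤ ∑ i, |f i| := by
  obtain ⟨i, hi⟩ := exists_eq_ciSup_of_finite (f := f)
  rw [← hi]
  exact Finset.single_le_sum (f := fun i => |f i|) (fun _ _ => abs_nonneg _) (Finset.mem_univ i)

lemma integrable_iSup {f : ι → α → ℝ} (hf : ∀ i, Integrable (f i) ρ) :
    Integrable (fun x => ⨆ i, f i x) ρ := by
  refine (integrable_finsetSum Finset.univ fun i _ => (hf i).abs).mono' ?_ ?_
  · exact (AEMeasurable.iSup fun i => (hf i).1.aemeasurable).aestronglyMeasurable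
  · exact ae_of_all _ fun x => abs_iSup_le_sum fun i => f i x

lemma integrable_coe_Lp [IsFiniteMeasure ρ] (f : Lp ℝ 2 ρ) : Integrable f ρ :=
  (Lp.memLp f).integrable (by norm_num)

lemma inner_Lp_real (f g : Lp ℝ 2 ρ) : ⟪f, g⟫ = ∫ x, f x * g x ∂ρ := by
  rw [L2.inner_def]
  refine integral_congr_ae (ae_of_all _ fun x => ?_)
  simp [mul_comm]

/-- A linear functional that is dominated by the integral of a finite maximum is given by a
measurable partition of unity. -/
lemma exists_partition_of_unity [IsProbabilityMeasure ρ] {V : Type*} [AddCommGroup V] [Module ℝ V]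
    (A : V →ₗ[ℝ] (ι → Lp ℝ 2 ρ)) (l : V →ₗ[ℝ] ℝ) (h : ∀ v, l v ≤ ∫ y, ⨆ i, A v i y ∂ρ) :
    ∃ θ : ι → Lp ℝ 2 ρ, (∀ i, ∀ᵐ y ∂ρ, 0 ≤ θ i y) ∧ (∀ᵐ y ∂ρ, ∑ i, θ i y = 1) ∧
      ∀ v, l v = ∑ i, ∫ y, θ i y * A v i y ∂ρ := by
  classical
  -- The sublinear functional for Hahn–Banach: `l` is transported to the range of `A`, extended
  -- under `N`, and represented coordinate by coordinate through Riesz.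
  let N : (ι → Lp ℝ 2 ρ) → ℝ := fun f => ∫ y, ⨆ i, f i y ∂ρ
  have hint : ∀ f : ι → Lp ℝ 2 ρ, Integrable (fun y => ⨆ i, f i y) ρ := fun f =>
    integrable_iSup fun i => integrable_coe_Lp (f i)
  have N_hom : ∀ c : ℝ, 0 < c → ∀ f, N (c • f) = c * N f := by
    intro c hc f
    simp only [N]
    rw [← integral_const_mul]
    refine integral_congr_ae ?_
    have : ∀ i, ∀ᵐ y ∂ρ, (c • f i : Lp ℝ 2 ρ) y = c * f i y := fun i => Lp.coeFn_smul c (f i)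
    filter_upwards [ae_all_iff.2 this] with y hy
    rw [Real.mul_iSup_of_nonneg hc.le]
    exact iSup_congr fun i => hy i
  have N_add : ∀ f g, N (f + g) ≤ N f + N g := by
    intro f g
    simp only [N]
    rw [← integral_add (hint f) (hint g)]
    refine integral_mono_ae (hint _) ((hint f).add (hint g)) ?_
    have : ∀ i, ∀ᵐ y ∂ρ, (f i + g i : Lp ℝ 2 ρ) y = f i y + g i y := fun i =>
      Lp.coeFn_add (f i) (g i)
    filter_upwards [ae_all_iff.2 this] with y hy
    refine le_trans (le_of_eq ?_) (iSup_add_le_of_finite _ _)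
    exact iSup_congr fun i => hy i
  have N_zero : N 0 = 0 := by
    have := N_hom 2 two_pos 0
    rw [smul_zero] at this
    linarith
  obtain ⟨s, hs⟩ := A.rangeRestrict.exists_rightInverse_of_surjective A.range_rangeRestrict
  have hs' : ∀ z, A (s z) = z := fun z => congrArg Subtype.val (LinearMap.congr_fun hs z)
  -- Domination at `v` and at `-v` shows that `l` factors through `A`, so the choice of the section
  -- `s` is immaterial.
  have hker : ∀ v, A v = 0 → l v = 0 := by
    intro v hv
    have h1 := h v
    have h2 := h (-v)
    have h3 : N (A v) = 0 := by rw [hv, N_zero]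
    have h4 : N (A (-v)) = 0 := by rw [map_neg, hv, neg_zero, N_zero]
    rw [map_neg] at h2
    simp only [N] at h3 h4
    linarith
  obtain ⟨G, hG1, hG2⟩ := exists_extension_of_le_sublinear
    ⟨LinearMap.range A, l ∘ₗ s⟩ N N_hom N_add (by
      intro z
      have := h (s z)
      rw [hs'] at this
      exact this)
  have hGA : ∀ v, G (A v) = l v := by
    intro v
    have h1 := hG1 ⟨A v, LinearMap.mem_range_self A v⟩
    have h2 : l (s ⟨A v, LinearMap.mem_range_self A v⟩ - v) = 0 :=
      hker _ (by rw [map_sub, hs', sub_self])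
    rw [map_sub] at h2
    refine h1.trans ?_
    change l (s _) = l v
    linarith
  -- The maximum of `f` in slot `i` and zeros elsewhere is at most `|f|`, and the `L¹` norm is at
  -- most the `L²` norm for a probability measure.
  have hbound : ∀ i (f : Lp ℝ 2 ρ), G (Pi.single i f) ≤ ‖f‖ := by
    intro i f
    refine (hG2 _).trans ?_
    have h1 : N (Pi.single i f) ≤ ∫ y, |f y| ∂ρ := by
      refine integral_mono_ae (hint _) (integrable_coe_Lp f).abs ?_
      filter_upwards [Lp.coeFn_zero ℝ 2 ρ] with y hy
      refine ciSup_le fun j => ?_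
      rcases eq_or_ne j i with rfl | hj
      · rw [Pi.single_eq_same]
        exact le_abs_self _
      · rw [Pi.single_eq_of_ne hj, hy]
        exact abs_nonneg _
    refine h1.trans ?_
    have h2 : ∫ y, |f y| ∂ρ = (eLpNorm f 1 ρ).toReal := by
      rw [eLpNorm_one_eq_lintegral_enorm,
        ← integral_norm_eq_lintegral_enorm (Lp.aestronglyMeasurable f)]
      rfl
    rw [h2, Lp.norm_def]
    exact ENNReal.toReal_mono (Lp.eLpNorm_ne_top f)
      (eLpNorm_le_eLpNorm_of_exponent_le (by norm_num) (Lp.aestronglyMeasurable f))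
  let Gc : ι → (Lp ℝ 2 ρ →L[ℝ] ℝ) := fun i =>
    (G ∘ₗ LinearMap.single ℝ _ i).mkContinuous 1 (by
      intro f
      rw [one_mul, Real.norm_eq_abs, abs_le]
      refine ⟨?_, hbound i f⟩
      have := hbound i (-f)
      rw [Pi.single_neg, map_neg, norm_neg] at this
      change -‖f‖ ≤ G (Pi.single i f)
      linarith)
  let θ : ι → Lp ℝ 2 ρ := fun i => (InnerProductSpace.toDual ℝ (Lp ℝ 2 ρ)).symm (Gc i)
  have hθ : ∀ i f, ⟪θ i, f⟫ = G (Pi.single i f) := fun i f =>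
    InnerProductSpace.toDual_symm_apply
  have hG : ∀ f, G f = ∑ i, ⟪θ i, f i⟫ := by
    intro f
    conv_lhs => rw [← Finset.univ_sum_single f]
    rw [map_sum]
    simp only [hθ]
  refine ⟨θ, ?_, ?_, ?_⟩
  · intro i
    have hm : MemLp (fun y => max (-θ i y) 0) 2 ρ := (Lp.memLp (θ i)).neg.pos_part
    -- Here `f` is the negative part of `θ i`. Testing `G` with `-f` in slot `i` gives `⟪θ i, f⟫ ≥
    -- 0`, whereas this product equals `-‖f‖²`.
    set f : Lp ℝ 2 ρ := hm.toLp _ with hf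
    have hfc : f =ᵐ[ρ] fun y => max (-θ i y) 0 := hm.coeFn_toLp
    have h1 : G (Pi.single i (-f)) ≤ 0 := by
      refine (hG2 _).trans ?_
      refine integral_nonpos_of_ae ?_
      filter_upwards [Lp.coeFn_zero ℝ 2 ρ, Lp.coeFn_neg f, hfc] with y h0 h1 h2
      refine ciSup_le fun j => ?_
      rcases eq_or_ne j i with rfl | hj
      · rw [Pi.single_eq_same, h1, Pi.neg_apply, h2]
        simp
      · rw [Pi.single_eq_of_ne hj, h0]
    rw [← hθ, inner_neg_right] at h1
    have h2 : ⟪θ i, f⟫ = - ⟪f, f⟫ := by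
      rw [inner_Lp_real, inner_Lp_real, ← integral_neg]
      refine integral_congr_ae ?_
      filter_upwards [hfc] with y hy
      rw [hy]
      rcases le_total 0 (-θ i y) with h3 | h3
      · rw [max_eq_left h3]; ring
      · rw [max_eq_right h3]; ring
    have h3 : ⟪f, f⟫ = 0 := le_antisymm (by linarith) real_inner_self_nonneg
    have h4 : f = 0 := inner_self_eq_zero.1 h3
    have h5 := Lp.coeFn_zero ℝ 2 ρ
    rw [← h4] at h5
    filter_upwards [h5, hfc] with y h6 h7
    have h8 : max (-θ i y) 0 = 0 := by rw [← h7, h6]; rfl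
    have := le_max_left (-θ i y) 0
    linarith
  · have hone : MemLp (fun _ : α => (1 : ℝ)) 2 ρ := memLp_const 1
    -- On constant tuples `N` is the integral itself; applying the bound to `f` and `-f` identifies
    -- `∑ i, θ i` with `1`.
    have hle : ∀ f : Lp ℝ 2 ρ, ∑ i, ⟪θ i, f⟫ ≤ ⟪hone.toLp _, f⟫ := by
      intro f
      rw [← hG fun _ => f]
      refine (hG2 _).trans ?_
      simp only [N, ciSup_const]
      rw [inner_Lp_real]
      refine le_of_eq (integral_congr_ae ?_)
      filter_upwards [hone.coeFn_toLp] with y hy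
      rw [hy, one_mul]
    have heq : ∑ i, θ i = hone.toLp _ := by
      refine ext_inner_right ℝ fun f => ?_
      rw [sum_inner]
      refine le_antisymm (hle f) ?_
      have := hle (-f)
      simp only [inner_neg_right, Finset.sum_neg_distrib] at this
      linarith
    have h1 := hone.coeFn_toLp
    rw [← heq] at h1
    filter_upwards [h1, Lp.coeFn_finsetSum Finset.univ θ] with y h2 h3
    rw [h3, Finset.sum_apply] at h2
    exact h2
  · intro v
    rw [← hGA, hG]
    simp only [inner_Lp_real]

end Sublinear

end

/-! ### Strassen's theorem, from finitely many cells to the general case -/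

section

variable {d : ℕ} {μ ν η : Measure (Space d)} {π : Measure (Space d × Space d)}

section Semidiscrete

variable {ι : Type*} [Fintype ι] [MeasurableSpace ι] [MeasurableSingletonClass ι]

/-- The coupling of `μ` and `ν` that transports each cell `a ⁻¹' {i}` to `θ i • ν`. -/
def cellCoupling (μ ν : Measure (Space d)) (a : Space d → ι) (θ : ι → Space d → ℝ) :
    Measure (Space d × Space d) :=
  ∑ i, (μ[|a ⁻¹' {i}]).prod (ν.withDensity fun y => ENNReal.ofReal (θ i y))

variable {a : Space d → ι} {θ : ι → Space d → ℝ}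

lemma cellCoupling_mem_couplings [IsProbabilityMeasure μ] [IsProbabilityMeasure ν]
    (ha : Measurable a) (hθi : ∀ i, Integrable (θ i) ν)
    (hθ0 : ∀ i, ∀ᵐ y ∂ν, 0 ≤ θ i y) (hθ1 : ∀ᵐ y ∂ν, ∑ i, θ i y = 1)
    (hθμ : ∀ i, ∫ y, θ i y ∂ν = μ.real (a ⁻¹' {i})) :
    cellCoupling μ ν a θ ∈ couplings μ ν := by
  have hmass : ∀ i, (ν.withDensity fun y => ENNReal.ofReal (θ i y)) Set.univ =
      μ (a ⁻¹' {i}) := by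
    intro i
    rw [withDensity_apply _ MeasurableSet.univ, Measure.restrict_univ,
      ← ofReal_integral_eq_lintegral_ofReal (hθi i) (hθ0 i), hθμ i, ofReal_measureReal]
  have hfin : ∀ i, IsFiniteMeasure (ν.withDensity fun y => ENNReal.ofReal (θ i y)) := fun i =>
    ⟨by rw [hmass i]; exact measure_lt_top _ _⟩
  constructor
  · rw [cellCoupling, Measure.map_finset_sum measurable_fst.aemeasurable]
    conv_rhs => rw [← sum_meas_smul_cond_fiber ha μ]
    refine Finset.sum_congr rfl fun i _ => ?_
    rw [Measure.map_fst_prod, hmass]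
  · rw [cellCoupling, Measure.map_finset_sum measurable_snd.aemeasurable]
    have h1 : ∀ i, ((μ[|a ⁻¹' {i}]).prod (ν.withDensity fun y => ENNReal.ofReal (θ i y))).map
        Prod.snd = ν.withDensity fun y => ENNReal.ofReal (θ i y) := by
      intro i
      rw [Measure.map_snd_prod]
      -- On a null cell the conditional measure is not a probability, but the matching piece of `ν`
      -- vanishes too.
      by_cases h0 : μ (a ⁻¹' {i}) = 0
      · have : (ν.withDensity fun y => ENNReal.ofReal (θ i y)) = 0 := by
          rw [← Measure.measure_univ_eq_zero, hmass i, h0]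
        rw [this, smul_zero]
      · have := cond_isProbabilityMeasure (μ := μ) h0
        rw [measure_univ, one_smul]
    simp only [h1]
    ext s hs
    rw [Measure.finsetSum_apply]
    simp only [withDensity_apply _ hs]
    rw [← lintegral_finsetSum' _ fun i _ => (hθi i).1.aemeasurable.ennreal_ofReal.restrict]
    have h2 : ∀ᵐ y ∂ν, ∑ i, ENNReal.ofReal (θ i y) = 1 := by
      filter_upwards [ae_all_iff.2 hθ0, hθ1] with y h3 h4
      rw [← ENNReal.ofReal_sum_of_nonneg fun i _ => h3 i, h4, ENNReal.ofReal_one]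
    rw [lintegral_congr_ae (ae_restrict_of_ae h2)]
    simp

lemma integral_cellCoupling [IsProbabilityMeasure μ] [IsProbabilityMeasure ν]
    (hν : MemLp id 2 ν) (ha : Measurable a) (hθi : ∀ i, Integrable (θ i) ν)
    (hθ0 : ∀ i, ∀ᵐ y ∂ν, 0 ≤ θ i y) (hθ1 : ∀ᵐ y ∂ν, ∑ i, θ i y = 1)
    (hθμ : ∀ i, ∫ y, θ i y ∂ν = μ.real (a ⁻¹' {i})) (c : ι → Space d) :
    ∫ p, ⟪c (a p.1), p.2⟫ ∂(cellCoupling μ ν a θ) = ∑ i, ∫ y, θ i y * ⟪c i, y⟫ ∂ν := by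
  have hmem := cellCoupling_mem_couplings ha hθi hθ0 hθ1 hθμ
  have hca : MemLp (fun x => c (a x)) 2 μ := by
    obtain ⟨C, hC⟩ := (Set.finite_range fun i => ‖c i‖).bddAbove
    exact MemLp.of_bound ((measurable_of_finite c).comp ha).aestronglyMeasurable C
      (ae_of_all _ fun x => hC ⟨a x, rfl⟩)
  have hint : Integrable (fun p => ⟪c (a p.1), p.2⟫) (cellCoupling μ ν a θ) :=
    couplings.integrable_inner_snd hmem hca hν
  rw [cellCoupling] at hint ⊢
  rw [integrable_finsetSum_measure] at hint
  rw [integral_finsetSum_measure hint]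
  refine Finset.sum_congr rfl fun i hi => ?_
  have hfin : IsFiniteMeasure (ν.withDensity fun y => ENNReal.ofReal (θ i y)) :=
    isFiniteMeasure_withDensity_ofReal (hθi i).2
  have e : ∫ y, θ i y * ⟪c i, y⟫ ∂ν =
      ∫ y, ⟪c i, y⟫ ∂(ν.withDensity fun y => ENNReal.ofReal (θ i y)) := by
    rw [integral_withDensity_eq_integral_toReal_smul₀ (hθi i).1.aemeasurable.ennreal_ofReal
      (ae_of_all _ fun _ => ENNReal.ofReal_lt_top)]
    refine integral_congr_ae ?_
    filter_upwards [hθ0 i] with y hy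
    rw [ENNReal.toReal_ofReal hy, smul_eq_mul]
  rw [e, integral_prod _ (hint i hi)]
  have h1 : ∀ᵐ x ∂(μ[|a ⁻¹' {i}]), a x = i :=
    ae_cond_mem (ha (measurableSet_singleton i))
  have h2 : ∫ x, ∫ y, ⟪c (a x), y⟫ ∂(ν.withDensity fun y => ENNReal.ofReal (θ i y))
        ∂(μ[|a ⁻¹' {i}]) =
      ∫ x, ∫ y, ⟪c i, y⟫ ∂(ν.withDensity fun y => ENNReal.ofReal (θ i y)) ∂(μ[|a ⁻¹' {i}]) := by
    refine integral_congr_ae ?_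
    filter_upwards [h1] with x hx
    rw [hx]
  rw [h2, integral_const]
  by_cases h0 : μ (a ⁻¹' {i}) = 0
  · have : (ν.withDensity fun y => ENNReal.ofReal (θ i y)) = 0 := by
      rw [← Measure.measure_univ_eq_zero, withDensity_apply _ MeasurableSet.univ,
        Measure.restrict_univ, ← ofReal_integral_eq_lintegral_ofReal (hθi i) (hθ0 i), hθμ i,
        ofReal_measureReal, h0]
    rw [this]
    simp
  · have := cond_isProbabilityMeasure (μ := μ) h0
    simp

/-- The semidiscrete core of Strassen's theorem. For a scalar `s` and weights `w`, the function
`max_i (s ⟪c i, y⟫ + w i)` is convex, so the convex order bounds its integral along `T` by its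
integral against `ν`; choosing `i = a x` instead of the maximum gives a linear functional of `(s,
w)` that is dominated. The resulting partition of unity `θ` tells how to split `ν` among the cells.
-/
lemma exists_coupling_integral_inner_eq [Nonempty ι] [IsProbabilityMeasure μ] (hν : ν ∈ P2 d)
    {T : Space d → Space d} (hT : MemLp T 2 μ) (hcx : ConvexOrder (μ.map T) ν)
    (ha : Measurable a) (c : ι → Space d) :
    ∃ π ∈ couplings μ ν, ∫ p, ⟪c (a p.1), p.2⟫ ∂π = ∫ x, ⟪c (a x), T x⟫ ∂μ := by
  classical
  have := isProbabilityMeasure_of_mem_P2 hν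
  have hν2 := memLp_id_of_mem_P2 hν
  rw [convexOrder_iff (map_mem_P2 hT) hν] at hcx
  have hinner : ∀ i, MemLp (fun y => ⟪c i, y⟫) 2 ν := fun i =>
    (innerSL ℝ (c i)).comp_memLp' hν2
  have hone : MemLp (fun _ : Space d => (1 : ℝ)) 2 ν := memLp_const 1
  let A : (ℝ × (ι → ℝ)) →ₗ[ℝ] (ι → Lp ℝ 2 ν) :=
    { toFun := fun v i => v.1 • (hinner i).toLp _ + v.2 i • hone.toLp _
      map_add' := fun v w => by
        ext1 i
        simp only [Prod.fst_add, Prod.snd_add, Pi.add_apply, add_smul]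
        abel
      map_smul' := fun r v => by
        ext1 i
        simp only [Prod.smul_fst, Prod.smul_snd, Pi.smul_apply, smul_add, smul_smul, smul_eq_mul,
          RingHom.id_apply] }
  have hA : ∀ v i, A v i =ᵐ[ν] fun y => v.1 * ⟪c i, y⟫ + v.2 i := by
    intro v i
    filter_upwards [Lp.coeFn_add (v.1 • (hinner i).toLp _) (v.2 i • hone.toLp _),
      Lp.coeFn_smul v.1 ((hinner i).toLp _), Lp.coeFn_smul (v.2 i) (hone.toLp _),
      (hinner i).coeFn_toLp, hone.coeFn_toLp] with y h1 h2 h3 h4 h5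
    change (v.1 • (hinner i).toLp _ + v.2 i • hone.toLp _ : Lp ℝ 2 ν) y = _
    rw [h1, Pi.add_apply, h2, h3, Pi.smul_apply, Pi.smul_apply, h4, h5]
    simp
  have hca : MemLp (fun x => c (a x)) 2 μ := by
    obtain ⟨C, hC⟩ := (Set.finite_range fun i => ‖c i‖).bddAbove
    exact MemLp.of_bound ((measurable_of_finite c).comp ha).aestronglyMeasurable C
      (ae_of_all _ fun x => hC ⟨a x, rfl⟩)
  have hcT := integrable_inner_of_memLp hca hT
  have hwa : ∀ w : ι → ℝ, Integrable (fun x => w (a x)) μ := by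
    intro w
    obtain ⟨C, hC⟩ := (Set.finite_range fun i => ‖w i‖).bddAbove
    exact Integrable.of_bound ((measurable_of_finite w).comp ha).aestronglyMeasurable C
      (ae_of_all _ fun x => hC ⟨a x, rfl⟩)
  let l : (ℝ × (ι → ℝ)) →ₗ[ℝ] ℝ :=
    { toFun := fun v => v.1 * ∫ x, ⟪c (a x), T x⟫ ∂μ + ∫ x, v.2 (a x) ∂μ
      map_add' := fun v w => by
        simp only [Prod.fst_add, Prod.snd_add, Pi.add_apply]
        rw [integral_add (hwa _) (hwa _)]
        ring
      map_smul' := fun r v => by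
        simp only [Prod.smul_fst, Prod.smul_snd, Pi.smul_apply, smul_eq_mul, RingHom.id_apply]
        rw [integral_const_mul]
        ring }
  have hl : ∀ v, l v ≤ ∫ y, ⨆ i, A v i y ∂ν := by
    intro v
    have hconv : ConvexOn ℝ Set.univ fun y : Space d => ⨆ i, (v.1 * ⟪c i, y⟫ + v.2 i) := by
      refine ⟨convex_univ, fun x _ y _ s t hs ht hst => ?_⟩
      refine ciSup_le fun i => ?_
      have h1 := le_ciSup (Set.finite_range fun i => v.1 * ⟪c i, x⟫ + v.2 i).bddAbove i
      have h2 := le_ciSup (Set.finite_range fun i => v.1 * ⟪c i, y⟫ + v.2 i).bddAbove i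
      have h3 := mul_le_mul_of_nonneg_left h1 hs
      have h4 := mul_le_mul_of_nonneg_left h2 ht
      simp only [inner_add_right, inner_smul_right, smul_eq_mul]
      have h5 : t = 1 - s := by linarith
      subst h5
      linarith
    have hi : Integrable (fun y : Space d => ⨆ i, (v.1 * ⟪c i, y⟫ + v.2 i)) ν :=
      integrable_iSup fun i => (((hinner i).integrable (by norm_num)).const_mul _).add
        (integrable_const _)
    obtain ⟨h1, h2⟩ := hcx _ hconv hi
    have hTm := hT.1.aemeasurable
    rw [(integrable_map_iff_and_integral hTm hconv).1] at h1
    rw [(integrable_map_iff_and_integral hTm hconv).2] at h2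
    have h3 : ∫ y, ⨆ i, A v i y ∂ν = ∫ y, ⨆ i, (v.1 * ⟪c i, y⟫ + v.2 i) ∂ν := by
      refine integral_congr_ae ?_
      filter_upwards [ae_all_iff.2 (hA v)] with y hy
      exact iSup_congr hy
    rw [h3]
    refine le_trans ?_ h2
    change v.1 * ∫ x, ⟪c (a x), T x⟫ ∂μ + ∫ x, v.2 (a x) ∂μ ≤ _
    rw [← integral_const_mul, ← integral_add (hcT.const_mul _) (hwa _)]
    refine integral_mono ((hcT.const_mul _).add (hwa _)) h1 fun x => ?_
    exact le_ciSup (Set.finite_range fun i => v.1 * ⟪c i, T x⟫ + v.2 i).bddAbove (a x)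
  obtain ⟨θ, hθ0, hθ1, hθ⟩ := exists_partition_of_unity A l hl
  have hθi : ∀ i, Integrable (θ i) ν := fun i => integrable_coe_Lp (θ i)
  -- Testing with `s = 0` and `w` a basis vector gives the mass of each cell; `s = 1`, `w = 0` below
  -- gives the correlation.
  have hθμ : ∀ i, ∫ y, θ i y ∂ν = μ.real (a ⁻¹' {i}) := by
    intro i
    have h1 := hθ (0, Pi.single i 1)
    have h2 : l (0, Pi.single i 1) = μ.real (a ⁻¹' {i}) := by
      change 0 * _ + ∫ x, (Pi.single i 1 : ι → ℝ) (a x) ∂μ = _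
      rw [zero_mul, zero_add, ← integral_indicator_one (ha (measurableSet_singleton i))]
      congr 1 with x
      simp [Set.indicator_apply, Pi.single_apply]
    rw [← h2, h1]
    have h3 : ∀ j, ∫ y, θ j y * A (0, Pi.single i 1) j y ∂ν =
        if j = i then ∫ y, θ i y ∂ν else 0 := by
      intro j
      split_ifs with hj
      · subst hj
        refine integral_congr_ae ?_
        filter_upwards [hA (0, Pi.single j 1) j] with y hy
        rw [hy]
        simp
      · refine integral_eq_zero_of_ae ?_
        filter_upwards [hA (0, Pi.single i 1) j] with y hy
        rw [hy]
        simp [hj]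
    simp [h3]
  refine ⟨cellCoupling μ ν a fun i => θ i, cellCoupling_mem_couplings ha hθi hθ0 hθ1 hθμ, ?_⟩
  rw [integral_cellCoupling hν2 ha hθi hθ0 hθ1 hθμ]
  have h1 := hθ (1, 0)
  have h2 : l (1, 0) = ∫ x, ⟪c (a x), T x⟫ ∂μ := by
    change 1 * _ + ∫ x, (0 : ι → ℝ) (a x) ∂μ = _
    simp
  rw [← h2, h1]
  refine Finset.sum_congr rfl fun i _ => integral_congr_ae ?_
  filter_upwards [hA (1, 0) i] with y hy
  rw [hy]
  simp

end Semidiscrete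

/-- Pair `S` with itself, apply Cauchy–Schwarz under the coupling, and divide by `‖S‖`. -/
lemma norm_le_of_mem_baryLp (hν : MemLp id 2 ν) {S : Lp (Space d) 2 μ} (hS : S ∈ baryLp μ ν) :
    ‖S‖ ≤ (eLpNorm (id : Space d → Space d) 2 ν).toReal := by
  obtain ⟨π, hπ, hS⟩ := hS
  have h1 := hS S (Lp.memLp S)
  have h2 := couplings.abs_integral_inner_le hπ (Lp.memLp S) hν
  simp only [id_eq] at h2
  rw [h1, ← L2.inner_def, real_inner_self_eq_norm_sq, abs_of_nonneg (by positivity),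
    ← Lp.norm_def, sq] at h2
  rcases (norm_nonneg S).eq_or_lt with h3 | h3
  · rw [← h3]
    exact ENNReal.toReal_nonneg
  · exact le_of_mul_le_mul_left h2 h3

/-- **Strassen's theorem**, in terms of barycentric projections: if `T#μ` is dominated by `ν`
in the convex order then `T` is the barycentric projection of a coupling of `μ` and `ν`. -/
theorem mem_baryLp_of_convexOrder [IsProbabilityMeasure μ] (hν : ν ∈ P2 d)
    (T : Lp (Space d) 2 μ) (hcx : ConvexOrder (μ.map T) ν) : T ∈ baryLp μ ν := by
  have := isProbabilityMeasure_of_mem_P2 hν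
  have hν2 := memLp_id_of_mem_P2 hν
  by_contra hTn
  -- If `T` were not a projection, a vector `g₀` would separate it strictly from all projections. A
  -- simple function `g` close to `g₀` has finitely many values, so the semidiscrete case yields a
  -- projection `S` with the same pairing with `g` as `T`.
  obtain ⟨f, u, hfu, hu⟩ := geometric_hahn_banach_closed_point (convex_baryLp hν2)
    (isClosed_baryLp hν2) hTn
  set g₀ : Lp (Space d) 2 μ := (InnerProductSpace.toDual ℝ (Lp (Space d) 2 μ)).symm f
  have hf : ∀ S, f S = ⟪g₀, S⟫ := fun S => InnerProductSpace.toDual_symm_apply.symm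
  -- A bound for `‖T - S‖` valid for every projection `S`, so that replacing `g₀` by `g` costs less
  -- than the separation gap.
  set R := (eLpNorm (id : Space d → Space d) 2 ν).toReal + ‖T‖
  have hR : 0 ≤ R := add_nonneg ENNReal.toReal_nonneg (norm_nonneg _)
  obtain ⟨g, hg⟩ : ∃ g : Lp.simpleFunc (Space d) 2 μ,
      dist g₀ (g : Lp (Space d) 2 μ) < (f T - u) / (R + 1) := by
    have := (Lp.simpleFunc.denseRange (E := Space d) (μ := μ) (p := 2) (by simp)).exists_dist_lt g₀
      (ε := (f T - u) / (R + 1)) (div_pos (by linarith) (by linarith))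
    exact this
  set G := Lp.simpleFunc.toSimpleFunc g
  have hG : G =ᵐ[μ] (g : Lp (Space d) 2 μ) := Lp.simpleFunc.toSimpleFunc_eq_toFun g
  have hGm : MemLp G 2 μ := Lp.simpleFunc.memLp g
  let _ : MeasurableSpace G.range := ⊤
  obtain ⟨x₀⟩ : Nonempty (Space d) := inferInstance
  have : Nonempty G.range := ⟨⟨G x₀, G.mem_range_self x₀⟩⟩
  let a : Space d → G.range := fun x => ⟨G x, G.mem_range_self x⟩
  have ha : Measurable a := by
    refine measurable_to_countable' fun i => ?_
    have : a ⁻¹' {i} = G ⁻¹' {i.1} := by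
      ext x
      simp [a, Subtype.ext_iff]
    rw [this]
    exact G.measurableSet_fiber _
  obtain ⟨π, hπ, heq⟩ := exists_coupling_integral_inner_eq hν (Lp.memLp T) hcx ha
    (fun i => (i : Space d))
  obtain ⟨k, _, rfl⟩ := exists_kernel_of_mem_couplings hπ
  set S : Lp (Space d) 2 μ := (memLp_kernelMean hν2 hπ).toLp _
  have hS : S ∈ baryLp μ ν := toLp_kernelMean_mem_baryLp hν2 hπ
  have hgi : ∀ W : Lp (Space d) 2 μ, ⟪(g : Lp (Space d) 2 μ), W⟫ = ∫ x, ⟪G x, W x⟫ ∂μ := by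
    intro W
    rw [L2.inner_def]
    refine integral_congr_ae ?_
    filter_upwards [hG] with x hx
    rw [hx]
  have heq' : ⟪(g : Lp (Space d) 2 μ), S⟫ = ⟪(g : Lp (Space d) 2 μ), T⟫ := by
    rw [hgi, hgi]
    change ∫ p, ⟪G p.1, p.2⟫ ∂(μ ⊗ₘ k) = ∫ x, ⟪G x, T x⟫ ∂μ at heq
    rw [← heq, integral_inner_kernelMean hν2 hπ hGm]
    refine integral_congr_ae ?_
    filter_upwards [(memLp_kernelMean hν2 hπ).coeFn_toLp] with x hx
    rw [hx]
  have h1 := hfu S hS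
  have h2 : f T - f S ≤ ‖g₀ - g‖ * R := by
    have h3 : f T - f S = ⟪g₀ - g, T - S⟫ := by
      rw [hf, hf, inner_sub_left, inner_sub_right, inner_sub_right, heq']
      ring
    rw [h3]
    refine (real_inner_le_norm _ _).trans ?_
    gcongr
    refine (norm_sub_le _ _).trans ?_
    rw [add_comm]
    exact add_le_add (norm_le_of_mem_baryLp hν2 hS) le_rfl
  rw [dist_eq_norm, lt_div_iff₀ (by linarith)] at hg
  have h4 : ‖g₀ - (g : Lp (Space d) 2 μ)‖ * R ≤ ‖g₀ - (g : Lp (Space d) 2 μ)‖ * (R + 1) := by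
    gcongr
    linarith
  linarith

end

/-! ### Minimization of convex functionals on bounded closed convex sets -/

section

section Hilbert

variable {H : Type*} [NormedAddCommGroup H] [InnerProductSpace ℝ H] [CompleteSpace H]

/-- A decreasing sequence of nonempty closed convex bounded sets of a Hilbert space has nonempty
intersection. -/
lemma nonempty_iInter_of_convex {K : ℕ → Set H} (hanti : Antitone K) (hne : ∀ n, (K n).Nonempty)
    (hcl : ∀ n, IsClosed (K n)) (hconv : ∀ n, Convex ℝ (K n)) {R : ℝ}
    (hR : ∀ x ∈ K 0, ‖x‖ ≤ R) : (⋂ n, K n).Nonempty := by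
  have hmin : ∀ n, ∃ v ∈ K n, ∀ w ∈ K n, ‖v‖ ≤ ‖w‖ := by
    intro n
    obtain ⟨v, hv, hv'⟩ :=
      exists_norm_eq_iInf_of_complete_convex (hne n) (hcl n).isComplete (hconv n) 0
    refine ⟨v, hv, fun w hw => ?_⟩
    simp only [zero_sub, norm_neg] at hv'
    rw [hv']
    exact ciInf_le ⟨0, by rintro _ ⟨w, rfl⟩; exact norm_nonneg _⟩ (⟨w, hw⟩ : K n)
  choose x hx hxmin using hmin
  have hmono : Monotone fun n => ‖x n‖ ^ 2 := fun n m hnm => by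
    have := hxmin n (x m) (hanti hnm (hx m))
    dsimp only
    gcongr
  have hbdd : BddAbove (Set.range fun n => ‖x n‖ ^ 2) := by
    refine ⟨R ^ 2, ?_⟩
    rintro _ ⟨n, rfl⟩
    have := hR (x n) (hanti (Nat.zero_le n) (hx n))
    dsimp only
    gcongr
  have hlim := tendsto_atTop_ciSup hmono hbdd
  set L := ⨆ n, ‖x n‖ ^ 2
  -- The midpoint lies in `K n`, so its norm is at least `‖x n‖`; the parallelogram law then gives
  -- `‖x n - x m‖² ≤ 2 (‖x m‖² - ‖x n‖²)`.
  have hdist : ∀ n m, n ≤ m → dist (x n) (x m) ≤ √(2 * (L - ‖x n‖ ^ 2)) := by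
    intro n m hnm
    have h1 : (1 / 2 : ℝ) • x n + (1 / 2 : ℝ) • x m ∈ K n :=
      hconv n (hx n) (hanti hnm (hx m)) (by norm_num) (by norm_num) (by norm_num)
    have h2 := hxmin n _ h1
    rw [← smul_add, norm_smul, Real.norm_of_nonneg (by norm_num)] at h2
    have h3 := parallelogram_law_with_norm ℝ (x n) (x m)
    have h4 : ‖x m‖ ^ 2 ≤ L := le_ciSup hbdd m
    have h5 : (2 * ‖x n‖) ^ 2 ≤ ‖x n + x m‖ ^ 2 := by
      gcongr
      linarith
    rw [dist_eq_norm]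
    refine Real.le_sqrt_of_sq_le ?_
    nlinarith
  have hcau : CauchySeq x := by
    refine cauchySeq_of_le_tendsto_0' _ hdist ?_
    have h1 : Tendsto (fun n => 2 * (L - ‖x n‖ ^ 2)) atTop (𝓝 (2 * (L - L))) :=
      (tendsto_const_nhds.sub hlim).const_mul 2
    have h2 := (Real.continuous_sqrt.tendsto _).comp h1
    rw [sub_self, mul_zero, Real.sqrt_zero] at h2
    exact h2
  obtain ⟨y, hy⟩ := cauchySeq_tendsto_of_complete hcau
  refine ⟨y, Set.mem_iInter.2 fun n => ?_⟩
  refine (hcl n).mem_of_tendsto hy ?_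
  filter_upwards [eventually_ge_atTop n] with m hm
  exact hanti hm (hx m)

/-- The sublevel sets at levels decreasing to the infimum are nested, and a common point is a
minimizer. If the infimum is infinite, any point will do. -/
lemma exists_forall_le_of_convex_sublevel {S : Set H} (hne : S.Nonempty) {R : ℝ}
    (hR : ∀ x ∈ S, ‖x‖ ≤ R) (F : H → ℝ≥0∞) (hcl : ∀ r, IsClosed {x ∈ S | F x ≤ r})
    (hconv : ∀ r, Convex ℝ {x ∈ S | F x ≤ r}) : ∃ x₀ ∈ S, ∀ x ∈ S, F x₀ ≤ F x := by
  set m := ⨅ x ∈ S, F x with hm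
  have hmle : ∀ x ∈ S, m ≤ F x := fun x hx => iInf₂_le x hx
  rcases eq_or_ne m ⊤ with h | h
  · obtain ⟨x₀, hx₀⟩ := hne
    refine ⟨x₀, hx₀, fun x hx => ?_⟩
    have := hmle x hx
    rw [h, top_le_iff] at this
    rw [this]
    exact le_top
  · obtain ⟨u, hu, hmem, hlim⟩ := exists_seq_strictAnti_tendsto' h.lt_top
    obtain ⟨x₀, hx₀⟩ := nonempty_iInter_of_convex (K := fun n => {x ∈ S | F x ≤ u n})
      (fun n k hnk x hx => ⟨hx.1, hx.2.trans (hu.antitone hnk)⟩)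
      (fun n => by
        have hn := (hmem n).1
        simp only [hm, iInf_lt_iff] at hn
        obtain ⟨x, hx, hxu⟩ := hn
        exact ⟨x, hx, hxu.le⟩)
      (fun n => hcl _) (fun n => hconv _) (fun x hx => hR x hx.1)
    rw [Set.mem_iInter] at hx₀
    refine ⟨x₀, (hx₀ 0).1, fun x hx => ?_⟩
    exact (ge_of_tendsto' hlim fun n => (hx₀ n).2).trans (hmle x hx)

end Hilbert

variable {d : ℕ} {μ : Measure (Space d)} {ψ : Space d → ℝ}

/-- Fatou's lemma along an almost everywhere convergent subsequence. -/
lemma isClosed_lintegral_le (hψ : Continuous ψ) (r : ℝ≥0∞) :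
    IsClosed {T : Lp (Space d) 2 μ | ∫⁻ x, ENNReal.ofReal (ψ (T x)) ∂μ ≤ r} := by
  refine IsSeqClosed.isClosed ?_
  intro T S hT hS
  obtain ⟨ns, -, hae⟩ := (tendstoInMeasure_of_tendsto_Lp hS).exists_seq_tendsto_ae
  have hm : ∀ n, AEMeasurable (fun x => ENNReal.ofReal (ψ (T (ns n) x))) μ := fun n =>
    (hψ.comp_aestronglyMeasurable (Lp.aestronglyMeasurable _)).aemeasurable.ennreal_ofReal
  calc ∫⁻ x, ENNReal.ofReal (ψ (S x)) ∂μ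
      = ∫⁻ x, liminf (fun n => ENNReal.ofReal (ψ (T (ns n) x))) atTop ∂μ := by
        refine lintegral_congr_ae ?_
        filter_upwards [hae] with x hx
        exact ((ENNReal.tendsto_ofReal ((hψ.tendsto _).comp hx)).liminf_eq).symm
    _ ≤ liminf (fun n => ∫⁻ x, ENNReal.ofReal (ψ (T (ns n) x)) ∂μ) atTop :=
        lintegral_liminf_le' hm
    _ ≤ r := by
        refine (liminf_le_liminf (Eventually.of_forall fun n => hT (ns n))).trans ?_
        simp

lemma convex_lintegral_le (hψ : ConvexOn ℝ Set.univ ψ) (r : ℝ≥0∞) :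
    Convex ℝ {T : Lp (Space d) 2 μ | ∫⁻ x, ENNReal.ofReal (ψ (T x)) ∂μ ≤ r} := by
  intro T hT S hS a b ha hb hab
  have hm : ∀ T : Lp (Space d) 2 μ, AEMeasurable (fun x => ENNReal.ofReal (ψ (T x))) μ := fun T =>
    ((continuous_of_convexOn hψ).comp_aestronglyMeasurable
      (Lp.aestronglyMeasurable _)).aemeasurable.ennreal_ofReal
  have hle : ∫⁻ x, ENNReal.ofReal (ψ ((a • T + b • S : Lp (Space d) 2 μ) x)) ∂μ ≤
      ∫⁻ x, (ENNReal.ofReal a * ENNReal.ofReal (ψ (T x)) +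
        ENNReal.ofReal b * ENNReal.ofReal (ψ (S x))) ∂μ := by
    refine lintegral_mono_ae ?_
    filter_upwards [Lp.coeFn_add (a • T) (b • S), Lp.coeFn_smul a T, Lp.coeFn_smul b S]
      with x h1 h2 h3
    rw [h1, Pi.add_apply, h2, h3, Pi.smul_apply, Pi.smul_apply]
    refine (ENNReal.ofReal_le_ofReal
      (hψ.2 (Set.mem_univ (T x)) (Set.mem_univ (S x)) ha hb hab)).trans ?_
    rw [smul_eq_mul, smul_eq_mul, ← ENNReal.ofReal_mul ha, ← ENNReal.ofReal_mul hb]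
    exact ENNReal.ofReal_add_le
  refine hle.trans ?_
  rw [lintegral_add_left' ((hm T).const_mul _), lintegral_const_mul'' _ (hm T),
    lintegral_const_mul'' _ (hm S)]
  calc _ ≤ ENNReal.ofReal a * r + ENNReal.ofReal b * r := by
        gcongr
        · exact hT
        · exact hS
    _ = r := by rw [← add_mul, ← ENNReal.ofReal_add ha hb, hab, ENNReal.ofReal_one, one_mul]

end

/-! ### Optimal barycentric projections and the minimization over `interSet μ ν` -/

section

variable {d : ℕ} {μ ν η : Measure (Space d)} {π π' : Measure (Space d × Space d)}
  {φ : Space d → ℝ}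

/-- The barycentric projections of the optimal couplings of `μ` and `ν`. -/
def baryOpt (μ ν : Measure (Space d)) : Set (Lp (Space d) 2 μ) :=
  {T | ∃ π ∈ optCouplings μ ν, IsBarycenter μ π T}

lemma IsBarycenter.corr_eq (hμ : μ ∈ P2 d) {T : Space d → Space d} (hT : IsBarycenter μ π T) :
    corr π = ∫ x, ⟪x, T x⟫ ∂μ :=
  hT id (memLp_id_of_mem_P2 hμ)

lemma corr_le_of_mem_optCouplings (hμ : μ ∈ P2 d) (hν : ν ∈ P2 d) (h : π ∈ optCouplings μ ν)
    (h' : π' ∈ couplings μ ν) : corr π' ≤ corr π :=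
  ((mem_optCouplings_iff hμ hν).1 h).2 π' h'

lemma exists_isBarycenter (hμ : μ ∈ P2 d) (hν : ν ∈ P2 d) (h : π ∈ couplings μ ν) :
    ∃ T : Lp (Space d) 2 μ, IsBarycenter μ π T := by
  have := isProbabilityMeasure_of_mem_P2 hμ
  have := isProbabilityMeasure_of_mem_P2 hν
  have hν2 := memLp_id_of_mem_P2 hν
  obtain ⟨k, _, rfl⟩ := exists_kernel_of_mem_couplings h
  refine ⟨(memLp_kernelMean hν2 h).toLp _, ?_⟩
  refine IsBarycenter.congr (T := kernelMean k) ?_ (memLp_kernelMean hν2 h).coeFn_toLp.symm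
  exact fun f hf => integral_inner_kernelMean hν2 h hf

/-- If `η ≤_cx ν`, the barycentric projections of couplings of `μ` and `η` are barycentric
projections of couplings of `μ` and `ν`. -/
lemma mem_baryLp_of_convexOrder_of_isBarycenter (hμ : μ ∈ P2 d) (hη : η ∈ P2 d) (hν : ν ∈ P2 d)
    (hcx : ConvexOrder η ν) (h : π ∈ couplings μ η) {T : Lp (Space d) 2 μ}
    (hT : IsBarycenter μ π T) : T ∈ baryLp μ ν := by
  have := isProbabilityMeasure_of_mem_P2 hμ
  exact mem_baryLp_of_convexOrder hν T ((convexOrder_map_of_isBarycenter hη h (Lp.memLp T) hT).trans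
    (map_mem_P2 (Lp.memLp T)) hη hν hcx)

/-- The projection of `π` is, by Strassen, also that of a coupling of `μ` and `ν`, which therefore
has the same correlation. -/
lemma corr_le_of_convexOrder (hμ : μ ∈ P2 d) (hη : η ∈ P2 d) (hν : ν ∈ P2 d)
    (hcx : ConvexOrder η ν) (h : π ∈ couplings μ η) (h' : π' ∈ optCouplings μ ν) :
    corr π ≤ corr π' := by
  obtain ⟨T, hT⟩ := exists_isBarycenter hμ hη h
  obtain ⟨ρ, hρ, hρT⟩ := mem_baryLp_of_convexOrder_of_isBarycenter hμ hη hν hcx h hT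
  rw [hT.corr_eq hμ, ← hρT.corr_eq hμ]
  exact corr_le_of_mem_optCouplings hμ hν h' hρ

/-- After expanding both Wasserstein distances, all second moments cancel. -/
lemma mem_interSet_iff (hμ : μ ∈ P2 d) (hη : η ∈ P2 d) (hν : ν ∈ P2 d)
    (h : π ∈ optCouplings μ η) (h' : π' ∈ optCouplings μ ν) :
    η ∈ interSet μ ν ↔ ConvexOrder η ν ∧ corr π = corr π' := by
  simp only [interSet, Set.mem_ofPred_eq, hη, true_and]
  rw [W2sq_toReal hμ hν h', W2sq_toReal hμ hη h]
  change _ ∧ _ = _ + secondMoment ν - secondMoment η ↔ _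
  constructor
  · rintro ⟨h1, h2⟩
    exact ⟨h1, by linarith⟩
  · rintro ⟨h1, h2⟩
    exact ⟨h1, by linarith⟩

/-- Correlation is a function of the projection alone, so any coupling with projection `T` may be
used to test optimality. -/
lemma mem_baryOpt_iff (hμ : μ ∈ P2 d) (hν : ν ∈ P2 d) (h : π ∈ optCouplings μ ν)
    {T : Lp (Space d) 2 μ} :
    T ∈ baryOpt μ ν ↔ T ∈ baryLp μ ν ∧ corr π = ∫ x, ⟪x, T x⟫ ∂μ := by
  constructor
  · rintro ⟨ρ, hρ, hT⟩
    refine ⟨⟨ρ, hρ.1, hT⟩, ?_⟩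
    rw [← hT.corr_eq hμ]
    exact le_antisymm (corr_le_of_mem_optCouplings hμ hν hρ h.1)
      (corr_le_of_mem_optCouplings hμ hν h hρ.1)
  · rintro ⟨⟨ρ, hρ, hT⟩, hc⟩
    refine ⟨ρ, (mem_optCouplings_iff hμ hν).2 ⟨hρ, fun π' h' => ?_⟩, hT⟩
    rw [hT.corr_eq hμ, ← hc]
    exact corr_le_of_mem_optCouplings hμ hν h h'

lemma mem_baryOpt_of_mem_interSet (hμ : μ ∈ P2 d) (hν : ν ∈ P2 d) (hη : η ∈ interSet μ ν)
    (h : π ∈ optCouplings μ η) {T : Lp (Space d) 2 μ} (hT : IsBarycenter μ π T) :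
    T ∈ baryOpt μ ν := by
  obtain ⟨π', h'⟩ := optCouplings_nonempty hμ hν
  have h1 := (mem_interSet_iff hμ hη.1 hν h h').1 hη
  rw [mem_baryOpt_iff hμ hν h']
  refine ⟨mem_baryLp_of_convexOrder_of_isBarycenter hμ hη.1 hν h1.1 h.1 hT, ?_⟩
  rw [← h1.2, hT.corr_eq hμ]

lemma convexOrder_map_of_mem_baryOpt (hμ : μ ∈ P2 d) (hν : ν ∈ P2 d) {T : Lp (Space d) 2 μ}
    (hT : T ∈ baryOpt μ ν) : ConvexOrder (μ.map T) ν := by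
  have := isProbabilityMeasure_of_mem_P2 hμ
  obtain ⟨π, h, hT⟩ := hT
  exact convexOrder_map_of_isBarycenter hν h.1 (Lp.memLp T) hT

lemma corr_map_graph {T : Lp (Space d) 2 μ} :
    corr (μ.map fun x => (x, T x)) = ∫ x, ⟪x, T x⟫ ∂μ := by
  rw [corr, integral_map (aemeasurable_id'.prodMk (Lp.aestronglyMeasurable T).aemeasurable)]
  · exact (by fun_prop : Continuous fun p : Space d × Space d => ⟪p.1, p.2⟫).aestronglyMeasurable

/-- The graph coupling of `μ` and `T#μ` already attains the optimal correlation of `μ` and `ν`; it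
cannot be exceeded because of the convex order. -/
lemma map_mem_interSet (hμ : μ ∈ P2 d) (hν : ν ∈ P2 d) {T : Lp (Space d) 2 μ}
    (hT : T ∈ baryOpt μ ν) : μ.map T ∈ interSet μ ν := by
  have := isProbabilityMeasure_of_mem_P2 hμ
  have hη : μ.map T ∈ P2 d := map_mem_P2 (Lp.memLp T)
  have hcx := convexOrder_map_of_mem_baryOpt hμ hν hT
  obtain ⟨π, h⟩ := optCouplings_nonempty hμ hη
  obtain ⟨π', h'⟩ := optCouplings_nonempty hμ hν
  refine (mem_interSet_iff hμ hη hν h h').2 ⟨hcx, ?_⟩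
  refine le_antisymm (corr_le_of_convexOrder hμ hη hν hcx h.1 h') ?_
  rw [((mem_baryOpt_iff hμ hν h').1 hT).2, ← corr_map_graph]
  exact corr_le_of_mem_optCouplings hμ hη h
    (map_graph_mem_couplings (Lp.aestronglyMeasurable T).aemeasurable)

lemma inner_toLp_left {f : Space d → Space d} (hf : MemLp f 2 μ) (T : Lp (Space d) 2 μ) :
    ⟪hf.toLp f, T⟫ = ∫ x, ⟪f x, T x⟫ ∂μ := by
  conv_lhs => rw [← Lp.toLp_coeFn T (Lp.memLp T)]
  rw [inner_toLp]

/-- As a slice by a closed hyperplane, `baryOpt μ ν` inherits convexity and closedness from `baryLp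
μ ν`. -/
lemma baryOpt_eq (hμ : μ ∈ P2 d) (hν : ν ∈ P2 d) (h : π ∈ optCouplings μ ν) :
    baryOpt μ ν = baryLp μ ν ∩
      {T | innerSL ℝ ((memLp_id_of_mem_P2 hμ).toLp id) T = corr π} := by
  ext T
  rw [mem_baryOpt_iff hμ hν h, Set.mem_inter_iff, Set.mem_ofPred_eq, innerSL_apply_apply,
    inner_toLp_left, eq_comm]
  rfl

lemma convex_baryOpt (hμ : μ ∈ P2 d) (hν : ν ∈ P2 d) : Convex ℝ (baryOpt μ ν) := by
  have := isProbabilityMeasure_of_mem_P2 hμ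
  have := isProbabilityMeasure_of_mem_P2 hν
  obtain ⟨π, h⟩ := optCouplings_nonempty hμ hν
  rw [baryOpt_eq hμ hν h]
  exact (convex_baryLp (memLp_id_of_mem_P2 hν)).inter
    (convex_hyperplane (LinearMap.isLinear (innerSL ℝ ((memLp_id_of_mem_P2 hμ).toLp id)).toLinearMap) _)

lemma isClosed_baryOpt (hμ : μ ∈ P2 d) (hν : ν ∈ P2 d) : IsClosed (baryOpt μ ν) := by
  have := isProbabilityMeasure_of_mem_P2 hμ
  have := isProbabilityMeasure_of_mem_P2 hν
  obtain ⟨π, h⟩ := optCouplings_nonempty hμ hν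
  rw [baryOpt_eq hμ hν h]
  exact (isClosed_baryLp (memLp_id_of_mem_P2 hν)).inter
    (isClosed_eq (ContinuousLinearMap.continuous _) continuous_const)

lemma baryOpt_nonempty (hμ : μ ∈ P2 d) (hν : ν ∈ P2 d) : (baryOpt μ ν).Nonempty := by
  obtain ⟨π, h⟩ := optCouplings_nonempty hμ hν
  obtain ⟨T, hT⟩ := exists_isBarycenter hμ hν h.1
  exact ⟨T, π, h, hT⟩

lemma integrable_comp_of_mem_baryOpt (hμ : μ ∈ P2 d) (hν : ν ∈ P2 d)
    (hφ : ConvexOn ℝ Set.univ φ) (hi : Integrable φ ν) {T : Lp (Space d) 2 μ}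
    (hT : T ∈ baryOpt μ ν) : Integrable (fun x => φ (T x)) μ := by
  have := isProbabilityMeasure_of_mem_P2 hμ
  have h1 := ((convexOrder_iff (map_mem_P2 (Lp.memLp T)) hν).1
    (convexOrder_map_of_mem_baryOpt hμ hν hT) φ hφ hi).1
  exact (integrable_map_iff_and_integral (Lp.aestronglyMeasurable T).aemeasurable hφ).1.1 h1

/-- The integral of a continuous linear form along a barycentric projection is determined by the
second marginal. -/
lemma integral_clm_of_mem_baryLp [IsProbabilityMeasure μ] (l : Space d →L[ℝ] ℝ)
    {T : Lp (Space d) 2 μ} (hT : T ∈ baryLp μ ν) : ∫ x, l (T x) ∂μ = ∫ y, l y ∂ν := by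
  obtain ⟨π, h, hT⟩ := hT
  set v := (InnerProductSpace.toDual ℝ (Space d)).symm l
  have hv : ∀ y, l y = ⟪v, y⟫ := fun y => InnerProductSpace.toDual_symm_apply.symm
  simp only [hv]
  rw [← hT (fun _ => v) (memLp_const v), ← h.2, integral_map measurable_snd.aemeasurable]
  exact (by fun_prop : Continuous fun y : Space d => ⟪v, y⟫).aestronglyMeasurable

lemma exists_minimizer_baryOpt (hμ : μ ∈ P2 d) (hν : ν ∈ P2 d) (hφ : ConvexOn ℝ Set.univ φ)
    (hi : Integrable φ ν) :
    ∃ T₀ ∈ baryOpt μ ν, ∀ T ∈ baryOpt μ ν, ∫ x, φ (T₀ x) ∂μ ≤ ∫ x, φ (T x) ∂μ := by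
  have := isProbabilityMeasure_of_mem_P2 hμ
  have := isProbabilityMeasure_of_mem_P2 hν
  obtain ⟨l, c, hl⟩ := exists_affine_le hφ
  -- Subtracting an affine minorant makes the integrand nonnegative, as Fatou requires; it shifts
  -- the functional by a constant, since all projections have the mean of `ν`.
  let ψ : Space d → ℝ := fun x => φ x - (l x + c)
  have hψ : ConvexOn ℝ Set.univ ψ := by
    refine hφ.sub ?_
    exact ((l : Space d →ₗ[ℝ] ℝ).concaveOn convex_univ).add (concaveOn_const c convex_univ)
  obtain ⟨T₀, hT₀, hmin⟩ := exists_forall_le_of_convex_sublevel (baryOpt_nonempty hμ hν)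
    (R := (eLpNorm (id : Space d → Space d) 2 ν).toReal)
    (fun T ⟨π, h, hT⟩ => norm_le_of_mem_baryLp (memLp_id_of_mem_P2 hν) ⟨π, h.1, hT⟩)
    (fun T => ∫⁻ x, ENNReal.ofReal (ψ (T x)) ∂μ)
    (fun r => (isClosed_baryOpt hμ hν).inter
      (isClosed_lintegral_le (continuous_of_convexOn hψ) r))
    (fun r => (convex_baryOpt hμ hν).inter (convex_lintegral_le hψ r))
  refine ⟨T₀, hT₀, fun T hT => ?_⟩
  have hint : ∀ T ∈ baryOpt μ ν, Integrable (fun x => ψ (T x)) μ ∧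
      ∫ x, ψ (T x) ∂μ = ∫ x, φ (T x) ∂μ - (∫ y, l y ∂ν + c) := by
    intro T hT
    have h1 := integrable_comp_of_mem_baryOpt hμ hν hφ hi hT
    have h2 := integrable_affine (Lp.memLp T) l c
    refine ⟨h1.sub h2, ?_⟩
    obtain ⟨π, h, hT⟩ := hT
    rw [← integral_clm_of_mem_baryLp l ⟨π, h.1, hT⟩, integral_sub h1 h2,
      integral_add (l.integrable_comp ((Lp.memLp T).integrable (by norm_num)))
        (integrable_const c)]
    simp
  have h0 : ∀ x, 0 ≤ ψ x := fun x => sub_nonneg.2 (hl x)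
  have h1 := hmin T hT
  rw [← ofReal_integral_eq_lintegral_ofReal (hint T₀ hT₀).1 (ae_of_all _ fun x => h0 _),
    ← ofReal_integral_eq_lintegral_ofReal (hint T hT).1 (ae_of_all _ fun x => h0 _),
    ENNReal.ofReal_le_ofReal_iff (integral_nonneg fun x => h0 _), (hint T₀ hT₀).2,
    (hint T hT).2] at h1
  linarith

/-- The midpoint of two minimizers is again admissible, and would do strictly better if they
differed on a set of positive measure. -/
lemma eq_of_integral_le_of_minimizer (hμ : μ ∈ P2 d) (hν : ν ∈ P2 d)
    (hφ : StrictConvexOn ℝ Set.univ φ) (hi : Integrable φ ν) {T₀ T : Lp (Space d) 2 μ}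
    (hT₀ : T₀ ∈ baryOpt μ ν) (hT : T ∈ baryOpt μ ν)
    (hmin : ∀ S ∈ baryOpt μ ν, ∫ x, φ (T₀ x) ∂μ ≤ ∫ x, φ (S x) ∂μ)
    (hle : ∫ x, φ (T x) ∂μ ≤ ∫ x, φ (T₀ x) ∂μ) : T = T₀ := by
  have hM := convex_baryOpt hμ hν hT₀ hT (a := 1 / 2) (b := 1 / 2) (by norm_num) (by norm_num)
    (by norm_num)
  set M := (1 / 2 : ℝ) • T₀ + (1 / 2 : ℝ) • T
  have i0 := integrable_comp_of_mem_baryOpt hμ hν hφ.convexOn hi hT₀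
  have i1 := integrable_comp_of_mem_baryOpt hμ hν hφ.convexOn hi hT
  have iM := integrable_comp_of_mem_baryOpt hμ hν hφ.convexOn hi hM
  have hMae : ∀ᵐ x ∂μ, M x = (1 / 2 : ℝ) • T₀ x + (1 / 2 : ℝ) • T x := by
    filter_upwards [Lp.coeFn_add ((1 / 2 : ℝ) • T₀) ((1 / 2 : ℝ) • T),
      Lp.coeFn_smul (1 / 2 : ℝ) T₀, Lp.coeFn_smul (1 / 2 : ℝ) T] with x h1 h2 h3
    rw [h1, Pi.add_apply, h2, h3, Pi.smul_apply, Pi.smul_apply]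
  have hMle : ∀ᵐ x ∂μ, φ (M x) ≤ 1 / 2 * φ (T₀ x) + 1 / 2 * φ (T x) := by
    filter_upwards [hMae] with x hx
    rw [hx]
    exact hφ.convexOn.2 (Set.mem_univ _) (Set.mem_univ _) (by norm_num) (by norm_num)
      (by norm_num)
  have iA : Integrable (fun x => 1 / 2 * φ (T₀ x) + 1 / 2 * φ (T x)) μ :=
    (i0.const_mul _).add (i1.const_mul _)
  have heq : ∫ x, φ (M x) ∂μ = ∫ x, (1 / 2 * φ (T₀ x) + 1 / 2 * φ (T x)) ∂μ := by
    refine le_antisymm (integral_mono_ae iM iA hMle) ?_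
    rw [integral_add (i0.const_mul _) (i1.const_mul _), integral_const_mul, integral_const_mul]
    have := hmin M hM
    linarith
  have hae := (integral_eq_iff_of_ae_le iM iA hMle).1 heq
  refine Lp.ext ?_
  filter_upwards [hae, hMae] with x h1 h2
  by_contra hne
  have h3 := hφ.2 (Set.mem_univ (T₀ x)) (Set.mem_univ (T x)) (Ne.symm hne)
    (show (0 : ℝ) < 1 / 2 by norm_num) (show (0 : ℝ) < 1 / 2 by norm_num) (by norm_num)
  rw [← h2, h1, smul_eq_mul, smul_eq_mul] at h3
  exact lt_irrefl _ h3

lemma map_mem_baryImages (hμ : μ ∈ P2 d) (hν : ν ∈ P2 d) {T : Lp (Space d) 2 μ}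
    (hT : T ∈ baryOpt μ ν) : μ.map T ∈ baryImages μ ν := by
  have := isProbabilityMeasure_of_mem_P2 hμ
  have := isProbabilityMeasure_of_mem_P2 hν
  obtain ⟨π, h, hT⟩ := hT
  obtain ⟨k, hk, rfl, hTk⟩ :=
    exists_kernel_of_isBarycenter (memLp_id_of_mem_P2 hν) h.1 (Lp.memLp T) hT
  exact ⟨k, hk, h, Measure.map_congr hTk⟩

/-- For strictly convex `φ`, the problem of minimizing `∫ φ dη` over `interSet μ ν` has exactly
one solution; it is the image of `μ` by a barycentric projection of an optimal coupling of `μ` and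
`ν`, which is also the unique optimal coupling of `μ` and this solution. -/
theorem exists_minimizers_eq_singleton (hμ : μ ∈ P2 d) (hν : ν ∈ P2 d)
    (hφ : StrictConvexOn ℝ Set.univ φ) (hφν : extIntegral φ ν < ⊤) :
    ∃ T : Lp (Space d) 2 μ, T ∈ baryOpt μ ν ∧
      minimizers (interSet μ ν) φ = {μ.map T} ∧
      optCouplings μ (μ.map T) = {μ.map fun x => (x, T x)} := by
  have := isProbabilityMeasure_of_mem_P2 hμ
  have hc := hφ.convexOn
  have hi := integrable_of_extIntegral_lt_top hc hν hφν
  obtain ⟨T₀, hT₀, hmin⟩ := exists_minimizer_baryOpt hμ hν hc hi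
  have hη₀ := map_mem_interSet hμ hν hT₀
  have hTm := (Lp.aestronglyMeasurable T₀).aemeasurable
  have hie : ∀ η ∈ interSet μ ν, Integrable φ η := fun η hη =>
    ((convexOrder_iff hη.1 hν).1 hη.2.1 φ hc hi).1
  have hmem : ∀ η ∈ interSet μ ν, ∀ π ∈ optCouplings μ η,
      ∃ k : Kernel (Space d) (Space d), ∃ T : Lp (Space d) 2 μ, IsMarkovKernel k ∧ μ ⊗ₘ k = π ∧
        T =ᵐ[μ] kernelMean k ∧ T ∈ baryOpt μ ν := by
    intro η hη π h
    have := isProbabilityMeasure_of_mem_P2 hη.1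
    obtain ⟨T, hT⟩ := exists_isBarycenter hμ hη.1 h.1
    obtain ⟨k, hk, e, hTk⟩ :=
      exists_kernel_of_isBarycenter (memLp_id_of_mem_P2 hη.1) h.1 (Lp.memLp T) hT
    exact ⟨k, T, hk, e, hTk, mem_baryOpt_of_mem_interSet hμ hν hη h hT⟩
  have hlower : ∀ η ∈ interSet μ ν, ∫ x, φ (T₀ x) ∂μ ≤ ∫ y, φ y ∂η := by
    intro η hη
    obtain ⟨π, h⟩ := optCouplings_nonempty hμ hη.1
    obtain ⟨k, T, _, rfl, hTk, hT⟩ := hmem η hη π h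
    refine (hmin T hT).trans ?_
    have h1 := (integral_map_kernelMean_le hη.1 h.1 hc (hie η hη)).2
    refine le_trans (le_of_eq (integral_congr_ae ?_)) h1
    filter_upwards [hTk] with x hx
    rw [hx]
  have hgraph : ∀ η ∈ interSet μ ν, ∫ y, φ y ∂η ≤ ∫ x, φ (T₀ x) ∂μ →
      ∀ π ∈ optCouplings μ η, π = μ.map fun x => (x, T₀ x) := by
    intro η hη hle π h
    obtain ⟨k, T, _, rfl, hTk, hT⟩ := hmem η hη π h
    have h1 : ∫ x, φ (T x) ∂μ = ∫ x, φ (kernelMean k x) ∂μ := by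
      refine integral_congr_ae ?_
      filter_upwards [hTk] with x hx
      rw [hx]
    have h2 := (integral_map_kernelMean_le hη.1 h.1 hc (hie η hη)).2
    have h3 : T = T₀ := eq_of_integral_le_of_minimizer hμ hν hφ hi hT₀ hT hmin (by linarith)
    have h4 := hmin T hT
    -- With `T = T₀`, the assumed bound on `∫ φ dη` is the reverse of Jensen's inequality, so the
    -- equality case applies.
    rw [eq_map_graph_kernelMean hη.1 h.1 hφ (hie η hη) (by linarith), ← h3]
    refine Measure.map_congr ?_
    filter_upwards [hTk] with x hx
    rw [hx]
  have hval : ∫ y, φ y ∂(μ.map T₀) = ∫ x, φ (T₀ x) ∂μ :=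
    (integrable_map_iff_and_integral hTm hc).2
  have hmap : ∀ η ∈ interSet μ ν, ∫ y, φ y ∂η ≤ ∫ x, φ (T₀ x) ∂μ → η = μ.map T₀ := by
    intro η hη hle
    obtain ⟨π, h⟩ := optCouplings_nonempty hμ hη.1
    rw [← h.1.2, hgraph η hη hle π h]
    exact (map_graph_mem_couplings hTm).2
  have hinf : ⨅ η ∈ interSet μ ν, extIntegral φ η = (∫ x, φ (T₀ x) ∂μ : ℝ) := by
    refine le_antisymm ?_ (le_iInf₂ fun η hη => ?_)
    · refine (iInf₂_le _ hη₀).trans ?_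
      rw [extIntegral_of_integrable (hie _ hη₀), hval]
    · rw [extIntegral_of_integrable (hie _ hη)]
      exact EReal.coe_le_coe_iff.2 (hlower η hη)
  refine ⟨T₀, hT₀, ?_, ?_⟩
  · ext η
    simp only [minimizers, Set.mem_ofPred_eq, Set.mem_singleton_iff, hinf]
    constructor
    · rintro ⟨hη, h⟩
      rw [extIntegral_of_integrable (hie _ hη)] at h
      exact hmap η hη (EReal.coe_eq_coe_iff.1 h).le
    · rintro rfl
      refine ⟨hη₀, ?_⟩
      rw [extIntegral_of_integrable (hie _ hη₀), hval]
  · refine Set.eq_singleton_iff_nonempty_unique_mem.2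
      ⟨optCouplings_nonempty hμ hη₀.1, hgraph _ hη₀ hval.le⟩

lemma minimizers_singleton (φ : Space d → ℝ) : minimizers {η} φ = {η} := by
  ext η'
  simp only [minimizers, Set.mem_ofPred_eq, Set.mem_singleton_iff, iInf_iInf_eq_left]
  constructor
  · exact fun h => h.1
  · rintro rfl
    exact ⟨rfl, rfl⟩

lemma strictConvexOn_norm_sq : StrictConvexOn ℝ Set.univ fun z : Space d => ‖z‖ ^ 2 := by
  refine ⟨convex_univ, fun x _ y _ hxy a b ha hb hab => ?_⟩
  have h1 : 0 < ‖x - y‖ ^ 2 := by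
    have := norm_pos_iff.2 (sub_ne_zero.2 hxy)
    positivity
  have h2 : ‖a • x + b • y‖ ^ 2 =
      a ^ 2 * ‖x‖ ^ 2 + 2 * (a * b) * ⟪x, y⟫ + b ^ 2 * ‖y‖ ^ 2 := by
    rw [norm_add_sq_real, norm_smul, norm_smul, inner_smul_left, inner_smul_right,
      Real.norm_of_nonneg ha.le, Real.norm_of_nonneg hb.le]
    simp only [conj_trivial]
    ring
  rw [norm_sub_sq_real] at h1
  have h3 := mul_pos (mul_pos ha hb) h1
  have h4 : b = 1 - a := by linarith
  simp only [smul_eq_mul]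
  rw [h2]
  subst h4
  nlinarith

lemma extIntegral_norm_sq_lt_top (hν : ν ∈ P2 d) : extIntegral (fun z => ‖z‖ ^ 2) ν < ⊤ := by
  have := isProbabilityMeasure_of_mem_P2 hν
  have h : Integrable (fun z : Space d => ‖z‖ ^ 2) ν :=
    (memLp_id_of_mem_P2 hν).integrable_norm_pow'
  rw [extIntegral_of_integrable h]
  exact EReal.coe_lt_top _

end

end QuadraticOT

end

theorem theorem1 (d : ℕ) (μ ν : MeasureTheory.Measure (QuadraticOT.Space d))
    (hμ : μ ∈ QuadraticOT.P2 d) (hν : ν ∈ QuadraticOT.P2 d) :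
    (∀ φ : QuadraticOT.Space d → ℝ, StrictConvexOn ℝ Set.univ φ →
      QuadraticOT.extIntegral φ ν < ⊤ →
        (QuadraticOT.minimizers (QuadraticOT.interSet μ ν) φ).Nonempty ∧
        QuadraticOT.minimizers (QuadraticOT.interSet μ ν) φ ⊆ QuadraticOT.baryImages μ ν ∧
        (∀ η ∈ QuadraticOT.minimizers (QuadraticOT.interSet μ ν) φ,
          ∃ T : QuadraticOT.Space d → QuadraticOT.Space d, Measurable T ∧
            QuadraticOT.optCouplings μ η = {μ.map (fun x => (x, T x))}) ∧
        (∃! η, η ∈ QuadraticOT.minimizers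
          (QuadraticOT.minimizers (QuadraticOT.interSet μ ν) φ) (fun z => ‖z‖ ^ 2))) ∧
    (∃! η, η ∈ QuadraticOT.minimizers (QuadraticOT.interSet μ ν) (fun z => ‖z‖ ^ 2)) := by
  constructor
  · intro φ hφ hφν
    obtain ⟨T, hT, hmin, hopt⟩ := QuadraticOT.exists_minimizers_eq_singleton hμ hν hφ hφν
    -- The set of minimizers is already a single point, so minimizing the second moment over it
    -- changes nothing.
    rw [hmin, QuadraticOT.minimizers_singleton]
    refine ⟨Set.singleton_nonempty _, ?_, ?_, ?_⟩
    · rw [Set.singleton_subset_iff]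
      exact QuadraticOT.map_mem_baryImages hμ hν hT
    · rintro _ rfl
      exact ⟨T, (Lp.stronglyMeasurable T).measurable, hopt⟩
    · exact ⟨_, rfl, fun _ h => h⟩
  · obtain ⟨T, -, hmin, -⟩ := QuadraticOT.exists_minimizers_eq_singleton hμ hν
      QuadraticOT.strictConvexOn_norm_sq (QuadraticOT.extIntegral_norm_sq_lt_top hν)
    rw [hmin]
    exact ⟨_, rfl, fun _ h => h⟩
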